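/- For a digraph $D$ and a set $S\subseteq V(D)$ with $|S|\ge 2$, let $\kappa_S(D)$ be the maximum number $p$ of strongly connected subgraphs $D_1,\dots,D_p$ of $D$, each containing $S$, such that $V(D_i)\cap V(D_j)=S$ and $A(D_i)\cap A(D_j)=\emptyset$ for all $1\le i<j\le p$. For $2\le k\le |V(D)|$, let $\kappa_k(D)=\min\{\kappa_S(D) : S\subseteq V(D),\ |S|=k\}$ be the strong subgraph $k$-connectivity of $D$. For a graph $G$, let $\overleftrightarrow{G}$ be its complete biorientation, that is, the digraph obtained from $G$ by replacing each edge $xy$ by the two arcs $xy$ and $yx$. Then $\kappa_2(\overleftrightarrow{G})$ can be computed in polynomial time: there are an algorithm (a program of a random access machine with unit cost whose arithmetic operations are addition and subtraction) and a polynomial $q$ such that, for every finite simple graph $G$ with at least two vertices, given by its order and its adjacency matrix, the algorithm halts after at most $q(s)$ steps, where $s$ is the bit size of the input, and outputs $\kappa_2(\overleftrightarrow{G})$. -/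

import Mathlib

/-! ### Strong subgraph connectivity of digraphs -/

/-- A subgraph of a digraph `D`: a set of vertices and a set of arcs of `D` between them. -/
structure Digraph.Subdigraph {V : Type*} (D : Digraph V) where
  /-- the vertex set of the subgraph -/
  verts : Set V
  /-- the arc relation of the subgraph -/
  Adj : V → V → Prop
  adj_sub : ∀ {u v : V}, Adj u v → D.Adj u v
  fst_mem : ∀ {u v : V}, Adj u v → u ∈ verts
  snd_mem : ∀ {u v : V}, Adj u v → v ∈ verts

/-- A subgraph is strong if it has a vertex and every vertex can be reached from every vertex
along arcs of the subgraph. In particular, a one-vertex digraph is strong. -/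
def Digraph.Subdigraph.IsStrong {V : Type*} {D : Digraph V} (H : D.Subdigraph) : Prop :=
  H.verts.Nonempty ∧ ∀ u ∈ H.verts, ∀ v ∈ H.verts, Relation.ReflTransGen H.Adj u v

/-- `D` contains `p` strong subgraphs `H 0, …, H (p - 1)`, each containing `S`, which are
`S`-internally disjoint: any two of them share exactly the vertices of `S`, and no arc. -/
def Digraph.HasInternallyDisjointStrong {V : Type*} (D : Digraph V) (S : Finset V) (p : ℕ) :
    Prop :=
  ∃ H : Fin p → D.Subdigraph,
    (∀ i, (H i).IsStrong ∧ (S : Set V) ⊆ (H i).verts) ∧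
    ∀ i j, i < j →
      (H i).verts ∩ (H j).verts = (S : Set V) ∧ ∀ u v, ¬ ((H i).Adj u v ∧ (H j).Adj u v)

/-- `κ_S(D)`: the maximum number of `S`-internally disjoint strong subgraphs of `D` containing
`S`. For a finite digraph and `2 ≤ |S|` the maximum exists,
see `Digraph.isGreatest_localStrongConnectivity`. -/
noncomputable def Digraph.localStrongConnectivity {V : Type*} (D : Digraph V) (S : Finset V) :
    ℕ :=
  sSup {p : ℕ | D.HasInternallyDisjointStrong S p}

theorem Digraph.isGreatest_localStrongConnectivity {V : Type*} [Fintype V] (D : Digraph V)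
    (S : Finset V) (hS : 2 ≤ S.card) :
    IsGreatest {p : ℕ | D.HasInternallyDisjointStrong S p} (D.localStrongConnectivity S) := by
  obtain ⟨x, hx, y, hy, hxy⟩ := Finset.one_lt_card.mp hS
  have hne : {p : ℕ | D.HasInternallyDisjointStrong S p}.Nonempty :=
    ⟨0, Fin.elim0, fun i => i.elim0, fun i => i.elim0⟩
  have hbdd : BddAbove {p : ℕ | D.HasInternallyDisjointStrong S p} := by
    refine ⟨Fintype.card V, ?_⟩
    rintro p ⟨H, h1, h2⟩
    -- the first arc of a walk from `x` to `y` differs for different subgraphs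
    have key : ∀ i, ∃ v, (H i).Adj x v := by
      intro i
      have hr := (h1 i).1.2 x ((h1 i).2 hx) y ((h1 i).2 hy)
      rcases Relation.ReflTransGen.cases_head hr with h | ⟨v, hv, _⟩
      · exact absurd h hxy
      · exact ⟨v, hv⟩
    choose g hg using key
    have hinj : Function.Injective g := by
      intro i j hij
      rcases lt_trichotomy i j with h | h | h
      · exact absurd ⟨hg i, hij ▸ hg j⟩ ((h2 i j h).2 x (g i))
      · exact h
      · exact absurd ⟨hg j, hij ▸ hg i⟩ ((h2 j i h).2 x (g j))
    simpa using Fintype.card_le_of_injective g hinj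
  exact ⟨Nat.sSup_mem hne hbdd, fun p hp => le_csSup hbdd hp⟩

/-- The strong subgraph `k`-connectivity `κ_k(D)`: the minimum of `κ_S(D)` over all `k`-subsets
`S` of the vertex set. It is meant for `2 ≤ k ≤ |V|`, where the minimum is over a nonempty set. -/
noncomputable def Digraph.strongConnectivity {V : Type*} (D : Digraph V) (k : ℕ) : ℕ :=
  sInf {m : ℕ | ∃ S : Finset V, S.card = k ∧ m = D.localStrongConnectivity S}

/-- The complete biorientation of a graph: every edge is replaced by the two opposite arcs. -/
def SimpleGraph.completeBiorientation {V : Type*} (G : SimpleGraph V) : Digraph V where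
  Adj u v := G.Adj u v

/-! ### Random access machines and polynomial time

The machine has registers `0, 1, 2, …`, addressed directly by the (finite) program, and memory
cells `0, 1, 2, …`, addressed indirectly through the content of a register; all of them hold
natural numbers. Every instruction costs one step. Addition and truncated subtraction are the only
arithmetic operations, so the number of bits of the largest number stored grows by at most one in
a step (constants of the program aside), and polynomial time on this machine is the same as
polynomial time on a Turing machine. -/

namespace RAM

/-- The instructions of the random access machine. -/
inductive Instr where
  /-- `reg r := c` -/
  | const (r c : ℕ)
  /-- `reg r := reg s + reg t` -/
  | add (r s t : ℕ)
  /-- `reg r := reg s - reg t`, which is `0` if `reg s < reg t` -/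
  | sub (r s t : ℕ)
  /-- `reg r := mem (reg s)` -/
  | load (r s : ℕ)
  /-- `mem (reg r) := reg s` -/
  | store (r s : ℕ)
  /-- continue at instruction number `l` -/
  | jump (l : ℕ)
  /-- continue at instruction number `l` if `reg r = 0`, and at the next instruction otherwise -/
  | jzero (r l : ℕ)

/-- A program is a finite list of instructions, numbered from `0`. -/
abbrev Program := List Instr

/-- A configuration of the machine: program counter, registers and memory. -/
structure Config where
  /-- the number of the instruction to be executed next -/
  pc : ℕ
  /-- the content of the registers -/
  reg : ℕ → ℕ
  /-- the content of the memory -/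
  mem : ℕ → ℕ

/-- The effect of a single instruction. -/
def Instr.exec : Instr → Config → Config
  | .const r c, ⟨pc, reg, mem⟩ => ⟨pc + 1, Function.update reg r c, mem⟩
  | .add r s t, ⟨pc, reg, mem⟩ => ⟨pc + 1, Function.update reg r (reg s + reg t), mem⟩
  | .sub r s t, ⟨pc, reg, mem⟩ => ⟨pc + 1, Function.update reg r (reg s - reg t), mem⟩
  | .load r s, ⟨pc, reg, mem⟩ => ⟨pc + 1, Function.update reg r (mem (reg s)), mem⟩
  | .store r s, ⟨pc, reg, mem⟩ => ⟨pc + 1, reg, Function.update mem (reg r) (reg s)⟩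
  | .jump l, ⟨_, reg, mem⟩ => ⟨l, reg, mem⟩
  | .jzero r l, ⟨pc, reg, mem⟩ => ⟨if reg r = 0 then l else pc + 1, reg, mem⟩

/-- The machine has halted when the program counter is not the number of an instruction. -/
def Halted (P : Program) (c : Config) : Prop :=
  P.length ≤ c.pc

/-- One step of the machine; a halted machine does not change any more. -/
def step (P : Program) (c : Config) : Config :=
  match P[c.pc]? with
  | some i => i.exec c
  | none => c

/-- The initial configuration on input `w`: the entries of `w` stand in the memory cells
`0, …, w.length - 1`, everything else is `0`. -/
def init (w : List ℕ) : Config where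
  pc := 0
  reg _ := 0
  mem i := w.getD i 0

/-- The size of an input: the total number of binary digits of its entries, plus one separator
for each of them. -/
def inputSize (w : List ℕ) : ℕ :=
  (w.map fun x => Nat.size x + 1).sum

/-- `f` is computable in polynomial time, where the inputs `a` are given by the words `enc a`:
there are one program and one polynomial such that on every input the program halts after at most
polynomially many steps in the size of the input, with the value of `f` in register `0`. -/
def PolyTimeComputable {α : Type*} (enc : α → List ℕ) (f : α → ℕ) : Prop :=
  ∃ (P : Program) (q : Polynomial ℕ), ∀ a : α, ∃ t ≤ q.eval (inputSize (enc a)),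
    Halted P ((step P)^[t] (init (enc a))) ∧ ((step P)^[t] (init (enc a))).reg 0 = f a

end RAM

/-! ### Finite graphs as inputs -/

/-- A finite graph on the vertices `0, …, n - 1`, with at least two vertices. -/
structure FiniteGraph where
  /-- the number of vertices -/
  n : ℕ
  two_le : 2 ≤ n
  /-- the graph itself -/
  graph : SimpleGraph (Fin n)

open Classical in
/-- The representation of a graph by its order, followed by the `n * n` entries of its adjacency
matrix, row by row: the entry number `i * n + j` is `1` if `i` and `j` are adjacent, else `0`. -/
noncomputable def FiniteGraph.encode (G : FiniteGraph) : List ℕ :=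
  G.n :: List.ofFn fun m : Fin (G.n * G.n) => if G.graph.Adj m.divNat m.modNat then 1 else 0

/-! Fix distinct vertices x and y. In a complete biorientation an undirected path from x to y is
already a strong subgraph, so the local connectivity is governed by disjoint paths, the edge xy
counting as one of them, and dually by vertex separators. Both sides are read off one bipartite
graph. Left vertices are those outside {x, y} not adjacent to y, right vertices those outside {x, y}
not adjacent to x, and u on the left is joined to v on the right if u = v or uv is an edge.

A matching is a partial injection. Following it from a neighbour a of x gives an orbit; orbits from
different neighbours are disjoint because no neighbour of x is a right vertex. An orbit missing y
and all neighbours of y ends at an uncovered left vertex. Hence there are at least deg x minus the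
number of uncovered left vertices many disjoint strong subgraphs
(`AuxMatching.hasInternallyDisjointStrong`). For equality a dual certificate is needed: integer
prices on the right with slack 1. Some value below |V| is not a price, and cutting the prices there
yields a set violating Hall's condition by the number of uncovered left vertices, which becomes a
separator of the right size (`AuxMatching.card_le_of_prices`, `card_le_of_separator`).

An auction produces matching and prices together: an unassigned left vertex takes its cheapest
neighbour, evicts the owner and raises the price by 1, unless the price has reached n
(`AuctionState.bid`). Each round in which the auction is not over raises the sum of prices, which is
at most n², so n³ rounds suffice (`Running.auction`). At the end, deg x minus the number of
unassigned left vertices is the local connectivity (`AuctionState.localStrongConnectivity`), and the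
algorithm minimises over all pairs.

The algorithm is written in a language whose only loops run n times, so termination and a polynomial
bound follow from the syntax (`Cmd.runsIn_compile`). -/

/-! ### A language of bounded loops, and its compiler -/

namespace RAM

/-- The registers and the memory of the machine. -/
structure Store where
  /-- the content of the registers -/
  reg : ℕ → ℕ
  /-- the content of the memory -/
  mem : ℕ → ℕ

/-- Write `v` into register `r`. -/
def Store.set (s : Store) (r v : ℕ) : Store :=
  ⟨Function.update s.reg r v, s.mem⟩

@[simp] theorem Store.set_mem (s : Store) (r v : ℕ) : (s.set r v).mem = s.mem := rfl

theorem Store.set_reg (s : Store) (r v k : ℕ) :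
    (s.set r v).reg k = if k = r then v else s.reg k := by
  simp [Store.set, Function.update_apply]

/-- The configuration with program counter `pc` and the given registers and memory. -/
def Store.at (s : Store) (pc : ℕ) : Config := ⟨pc, s.reg, s.mem⟩

/-- Structured programs. Register `1` holds the number of iterations of every loop, register `2`
holds `0` and register `3` holds `1`. -/
inductive Cmd where
  | skip
  | const (r c : ℕ)
  | add (r s t : ℕ)
  | sub (r s t : ℕ)
  | load (r s : ℕ)
  | store (r s : ℕ)
  | seq (c d : Cmd)
  /-- execute `c` if register `r` is not `0`, and `d` otherwise -/
  | ite (r : ℕ) (c d : Cmd)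
  /-- execute `c` for all values of the register `r` below the content of register `1`,
  in decreasing order -/
  | loop (r : ℕ) (c : Cmd)

/-- Apply `f` for the values `k - 1, …, 0` of the register `r`. -/
def countdown (f : Store → Store) (r : ℕ) : ℕ → Store → Store
  | 0, s => s.set r 0
  | k + 1, s => countdown f r k (f (s.set r k))

namespace Cmd

/-- The effect of a structured program. -/
def eval : Cmd → Store → Store
  | skip, s => s
  | const r c, s => s.set r c
  | add r a b, s => s.set r (s.reg a + s.reg b)
  | sub r a b, s => s.set r (s.reg a - s.reg b)
  | load r a, s => s.set r (s.mem (s.reg a))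
  | store r a, s => ⟨s.reg, Function.update s.mem (s.reg r) (s.reg a)⟩
  | seq c d, s => d.eval (c.eval s)
  | ite r c d, s => if s.reg r = 0 then d.eval s else c.eval s
  | loop r c, s => countdown c.eval r (s.reg 1) s

/-- The registers that a structured program may change. -/
def writes : Cmd → List ℕ
  | skip => []
  | const r _ => [r]
  | add r _ _ => [r]
  | sub r _ _ => [r]
  | load r _ => [r]
  | store _ _ => []
  | seq c d => c.writes ++ d.writes
  | ite _ c d => c.writes ++ d.writes
  | loop r c => r :: c.writes

/-- Whether a structured program leaves the memory alone. -/
def readOnly : Cmd → Bool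
  | store _ _ => false
  | seq c d => c.readOnly && d.readOnly
  | ite _ c d => c.readOnly && d.readOnly
  | loop _ c => c.readOnly
  | _ => true

/-- No loop body changes its loop register. -/
def LoopsOk : Cmd → Prop
  | seq c d => c.LoopsOk ∧ d.LoopsOk
  | ite _ c d => c.LoopsOk ∧ d.LoopsOk
  | loop r c => r ∉ c.writes ∧ c.LoopsOk
  | _ => True

theorem countdown_reg {f : Store → Store} {q : ℕ} (hf : ∀ s, (f s).reg q = s.reg q) {r : ℕ}
    (hr : q ≠ r) (k : ℕ) (s : Store) : (countdown f r k s).reg q = s.reg q := by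
  induction k generalizing s with
  | zero => simp [countdown, Store.set_reg, hr]
  | succ k ih => simp [countdown, ih, hf, Store.set_reg, hr]

theorem countdown_mem {f : Store → Store} (hf : ∀ s, (f s).mem = s.mem) (r k : ℕ) (s : Store) :
    (countdown f r k s).mem = s.mem := by
  induction k generalizing s with
  | zero => rfl
  | succ k ih => simp [countdown, ih, hf]

/-- A register that is not written to keeps its content. -/
theorem eval_reg {c : Cmd} {q : ℕ} (h : q ∉ c.writes) (s : Store) :
    (c.eval s).reg q = s.reg q := by
  induction c generalizing s with
  | skip => rfl
  | store => rfl
  | const | add | sub | load => simp_all [writes, eval, Store.set_reg]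
  | seq c d hc hd => simp_all [writes, eval]
  | ite r c d hc hd =>
    simp only [writes, List.mem_append, not_or] at h
    simp only [eval]
    split
    · exact hd h.2 s
    · exact hc h.1 s
  | loop r c hc =>
    simp only [writes, List.mem_cons, not_or] at h
    exact countdown_reg (hc h.2) h.1 _ s

theorem eval_mem {c : Cmd} (h : c.readOnly = true) (s : Store) : (c.eval s).mem = s.mem := by
  induction c generalizing s with
  | skip | const | add | sub | load => rfl
  | store => simp [readOnly] at h
  | seq c d hc hd => simp_all [readOnly, eval]
  | ite r c d hc hd =>
    simp only [readOnly, Bool.and_eq_true] at h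
    simp only [eval]
    split
    · exact hd h.2 s
    · exact hc h.1 s
  | loop r c hc => exact countdown_mem (hc h) r _ s

/-- The invariant rule for loops. -/
theorem countdown_induction {f : Store → Store} {r : ℕ} (I : ℕ → Store → Prop) {k : ℕ}
    {s : Store} (h : I k s) (hstep : ∀ i < k, ∀ s, I (i + 1) s → I i (f (s.set r i)))
    (hend : ∀ s, I 0 s → I 0 (s.set r 0)) : I 0 (countdown f r k s) := by
  induction k generalizing s with
  | zero => exact hend s h
  | succ k ih =>
    exact ih (hstep k k.lt_succ_self s h) fun i hi => hstep i (hi.trans k.lt_succ_self)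

/-- The number of instructions of the compiled program. -/
def size : Cmd → ℕ
  | skip => 0
  | seq c d => c.size + d.size
  | ite _ c d => c.size + d.size + 2
  | loop _ c => c.size + 4
  | _ => 1

/-- The machine program of a structured program, for the position `o`. -/
def compile : Cmd → ℕ → Program
  | skip, _ => []
  | const r c, _ => [.const r c]
  | add r a b, _ => [.add r a b]
  | sub r a b, _ => [.sub r a b]
  | load r a, _ => [.load r a]
  | store r a, _ => [.store r a]
  | seq c d, o => c.compile o ++ d.compile (o + c.size)
  | ite r c d, o => .jzero r (o + 1 + c.size + 1) ::
      (c.compile (o + 1) ++ .jump (o + 1 + c.size + 1 + d.size) :: d.compile (o + 1 + c.size + 1))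
  | loop r c, o => .add r 1 2 :: .jzero r (o + c.size + 4) :: .sub r r 3 ::
      (c.compile (o + 1 + 1 + 1) ++ [.jump (o + 1)])

@[simp] theorem length_compile (c : Cmd) (o : ℕ) : (c.compile o).length = c.size := by
  induction c generalizing o with
  | seq c d hc hd => simp [compile, size, hc, hd]
  | ite r c d hc hd => simp [compile, size, hc, hd]; omega
  | loop r c hc => simp [compile, size, hc]
  | _ => rfl

/-- A bound for the running time in terms of the content of register `1`. -/
noncomputable def cost : Cmd → Polynomial ℕ
  | skip => 0
  | seq c d => c.cost + d.cost
  | ite _ c d => c.cost + d.cost + 2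
  | loop _ c => Polynomial.X * (c.cost + 3) + 2
  | _ => 1

end Cmd

/-! ### Code placement, running time and compiler correctness -/

/-- The instructions `l` stand in the program `P` at position `o`. -/
def CodeAt (P : Program) (o : ℕ) (l : Program) : Prop :=
  ∀ (k : ℕ) (i : Instr), l[k]? = some i → P[o + k]? = some i

theorem CodeAt.head {P : Program} {o : ℕ} {i : Instr} {l : Program} (h : CodeAt P o (i :: l)) :
    P[o]? = some i := h 0 i rfl

theorem CodeAt.tail {P : Program} {o : ℕ} {i : Instr} {l : Program} (h : CodeAt P o (i :: l)) :
    CodeAt P (o + 1) l := fun k j hj => by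
  have := h (k + 1) j (by simpa using hj)
  rwa [show o + (k + 1) = o + 1 + k by omega] at this

theorem CodeAt.left {P : Program} {o : ℕ} {l m : Program} (h : CodeAt P o (l ++ m)) :
    CodeAt P o l := fun k j hj => h k j (by
  rw [List.getElem?_append_left (List.getElem?_eq_some_iff.mp hj).1, hj])

theorem CodeAt.right {P : Program} {o : ℕ} {l m : Program} (h : CodeAt P o (l ++ m)) :
    CodeAt P (o + l.length) m := fun k j hj => by
  have := h (l.length + k) j (by
    rw [List.getElem?_append_right (by omega)]; simpa using hj)
  rwa [← add_assoc] at this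

/-- The machine gets from `c` to `c'` in at most `b` steps. -/
def RunsIn (P : Program) (b : ℕ) (c c' : Config) : Prop :=
  ∃ t ≤ b, (step P)^[t] c = c'

theorem RunsIn.refl (P : Program) (b : ℕ) (c : Config) : RunsIn P b c c := ⟨0, b.zero_le, rfl⟩

theorem RunsIn.trans {P : Program} {a b : ℕ} {c c' c'' : Config} (h : RunsIn P a c c')
    (h' : RunsIn P b c' c'') : RunsIn P (a + b) c c'' := by
  obtain ⟨t, ht, rfl⟩ := h
  obtain ⟨u, hu, rfl⟩ := h'
  exact ⟨u + t, by omega, Function.iterate_add_apply _ _ _ _⟩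

theorem RunsIn.mono {P : Program} {a b : ℕ} {c c' : Config} (h : RunsIn P a c c') (hab : a ≤ b) :
    RunsIn P b c c' :=
  let ⟨t, ht, e⟩ := h
  ⟨t, ht.trans hab, e⟩

theorem RunsIn.one {P : Program} {i : Instr} {c c' : Config} (h : P[c.pc]? = some i)
    (h' : i.exec c = c') : RunsIn P 1 c c' :=
  ⟨1, le_rfl, by simp [step, h, h']⟩

namespace Cmd

/-- The compiler is correct, and the running time is bounded by `cost`. -/
theorem runsIn_compile {P : Program} (c : Cmd) (hc : c.LoopsOk) (h1 : 1 ∉ c.writes)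
    (h2 : 2 ∉ c.writes) (h3 : 3 ∉ c.writes) {o : ℕ} (hP : CodeAt P o (c.compile o)) (s : Store)
    (hs2 : s.reg 2 = 0) (hs3 : s.reg 3 = 1) :
    RunsIn P (c.cost.eval (s.reg 1)) (s.at o) ((c.eval s).at (o + c.size)) := by
  induction c generalizing o s with
  | skip => exact RunsIn.refl _ _ _
  | const | add | sub | load | store =>
    simp only [cost, Polynomial.eval_one]
    exact RunsIn.one hP.head rfl
  | seq c d ihc ihd =>
    simp only [writes, List.mem_append, not_or] at h1 h2 h3
    have hd := hP.right
    rw [length_compile] at hd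
    have r1 := ihc hc.1 h1.1 h2.1 h3.1 hP.left s hs2 hs3
    have r2 := ihd hc.2 h1.2 h2.2 h3.2 hd (c.eval s) (by rw [eval_reg h2.1, hs2])
      (by rw [eval_reg h3.1, hs3])
    rw [eval_reg h1.1] at r2
    simpa [cost, size, eval, add_assoc] using r1.trans r2
  | ite r c d ihc ihd =>
    simp only [writes, List.mem_append, not_or] at h1 h2 h3
    have hd := hP.tail.right
    rw [length_compile] at hd
    by_cases hr : s.reg r = 0
    · have r1 : RunsIn P 1 (s.at o) (s.at (o + 1 + c.size + 1)) :=
        RunsIn.one hP.head (by simp [Store.at, Instr.exec, hr])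
      have r2 := ihd hc.2 h1.2 h2.2 h3.2 hd.tail s hs2 hs3
      have e : o + (ite r c d).size = o + 1 + c.size + 1 + d.size := by simp only [size]; omega
      simp only [eval, hr, if_true, e]
      refine (r1.trans r2).mono ?_
      simp only [cost, Polynomial.eval_add, Polynomial.eval_ofNat]
      omega
    · have r1 : RunsIn P 1 (s.at o) (s.at (o + 1)) :=
        RunsIn.one hP.head (by simp [Store.at, Instr.exec, hr])
      have r2 := ihc hc.1 h1.1 h2.1 h3.1 hP.tail.left s hs2 hs3
      have e : o + (ite r c d).size = o + 1 + c.size + 1 + d.size := by simp only [size]; omega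
      have r3 : RunsIn P 1 ((c.eval s).at (o + 1 + c.size))
          ((c.eval s).at (o + 1 + c.size + 1 + d.size)) :=
        RunsIn.one hd.head rfl
      simp only [eval, hr, if_false, e]
      refine ((r1.trans r2).trans r3).mono ?_
      simp only [cost, Polynomial.eval_add, Polynomial.eval_ofNat]
      omega
  | loop r c ih =>
    simp only [writes, List.mem_cons, not_or] at h1 h2 h3
    have r0 : RunsIn P 1 (s.at o) ((s.set r (s.reg 1)).at (o + 1)) :=
      RunsIn.one hP.head (by simp [Store.at, Store.set, Instr.exec, hs2])
    have hj := hP.tail.tail.tail.right.head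
    rw [length_compile] at hj
    -- Started at the loop test, with `k` iterations left: each iteration adds a test, a decrement
    -- and a jump to the cost of the body, and one last test leaves the loop.
    have key : ∀ (k : ℕ) (s' : Store), s'.reg r = k → s'.reg 1 = s.reg 1 → s'.reg 2 = 0 →
        s'.reg 3 = 1 → RunsIn P (k * (c.cost.eval (s.reg 1) + 3) + 1) (s'.at (o + 1))
          ((countdown c.eval r k s').at (o + c.size + 4)) := by
      intro k
      induction k with
      | zero =>
        intro s' hr _ _ _
        have : s'.set r 0 = s' := by
          unfold Store.set
          rw [← hr, Function.update_eq_self]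
        simp only [countdown, this, zero_mul, zero_add]
        exact RunsIn.one hP.tail.head (by simp [Store.at, Instr.exec, hr])
      | succ k ihk =>
        intro s' hr e1 e2 e3
        have r1 : RunsIn P 1 (s'.at (o + 1)) (s'.at (o + 1 + 1)) :=
          RunsIn.one hP.tail.head (by simp [Store.at, Instr.exec, hr])
        have r2 : RunsIn P 1 (s'.at (o + 1 + 1)) ((s'.set r k).at (o + 1 + 1 + 1)) :=
          RunsIn.one hP.tail.tail.head (by simp [Store.at, Store.set, Instr.exec, hr, e3])
        have f : ∀ q, q ≠ r → (s'.set r k).reg q = s'.reg q := fun q hq => by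
          simp [Store.set_reg, hq]
        have r3 := ih hc.2 h1.2 h2.2 h3.2 hP.tail.tail.tail.left (s'.set r k)
          (by rw [f 2 h2.1, e2]) (by rw [f 3 h3.1, e3])
        have r4 : RunsIn P 1 ((c.eval (s'.set r k)).at (o + 1 + 1 + 1 + c.size))
            ((c.eval (s'.set r k)).at (o + 1)) := RunsIn.one hj rfl
        have r5 := ihk (c.eval (s'.set r k)) (by rw [eval_reg hc.1]; simp [Store.set_reg])
          (by rw [eval_reg h1.2, f 1 h1.1, e1]) (by rw [eval_reg h2.2, f 2 h2.1, e2])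
          (by rw [eval_reg h3.2, f 3 h3.1, e3])
        refine ((((r1.trans r2).trans r3).trans r4).trans r5).mono ?_
        rw [f 1 h1.1, e1]
        ring_nf
        omega
    -- `countdown` overwrites `r` before anything reads it, so the machine's initialisation of the
    -- counter is invisible.
    have e : ∀ k, countdown c.eval r k (s.set r (s.reg 1)) = countdown c.eval r k s := by
      intro k
      cases k <;> simp [countdown, Store.set]
    have := key (s.reg 1) (s.set r (s.reg 1)) (by simp [Store.set_reg])
      (by simp [Store.set_reg]) (by simp [Store.set_reg, h2.1, hs2])
      (by simp [Store.set_reg, h3.1, hs3])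
    rw [e] at this
    refine (r0.trans this).mono ?_
    simp only [cost, Polynomial.eval_add, Polynomial.eval_mul, Polynomial.eval_X,
      Polynomial.eval_ofNat]
    omega

end Cmd

end RAM

/-! ### Internally disjoint strong subgraphs between two vertices -/

section TwoVertices

variable {V : Type*} {G : SimpleGraph V} {x y : V}

open Classical in
/-- Pairwise disjoint strong subgraphs may be indexed by a finite set of vertices. -/
theorem Digraph.hasInternallyDisjointStrong_of_finset {W : Type*} {D : Digraph W} {S : Finset W}
    {ι : Type*} (I : Finset ι) (H : ι → D.Subdigraph)
    (h1 : ∀ i ∈ I, (H i).IsStrong ∧ (S : Set W) ⊆ (H i).verts)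
    (h2 : ∀ i ∈ I, ∀ j ∈ I, i ≠ j →
      (H i).verts ∩ (H j).verts = (S : Set W) ∧ ∀ u v, ¬ ((H i).Adj u v ∧ (H j).Adj u v))
    {p : ℕ} (hp : p ≤ I.card) : D.HasInternallyDisjointStrong S p := by
  obtain ⟨f⟩ : Nonempty (Fin p ↪ I) :=
    Function.Embedding.nonempty_of_card_le (by simpa using hp)
  refine ⟨fun i => H (f i), fun i => h1 _ (f i).2, fun i j hij => h2 _ (f i).2 _ (f j).2 ?_⟩
  exact fun h => hij.ne (f.injective (Subtype.ext h))

/-! ### The auxiliary bipartite graph and the subgraphs given by a matching -/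

/-- The left vertices of the auxiliary bipartite graph. -/
def IsLeft (G : SimpleGraph V) (x y u : V) : Prop := u ≠ x ∧ u ≠ y ∧ ¬ G.Adj y u

/-- The right vertices of the auxiliary bipartite graph. -/
def IsRight (G : SimpleGraph V) (x y v : V) : Prop := v ≠ x ∧ v ≠ y ∧ ¬ G.Adj x v

/-- A matching of the auxiliary bipartite graph, in which the left vertex `u` and the right vertex
`v` are joined if they are equal or adjacent in `G`. -/
structure AuxMatching (G : SimpleGraph V) (x y : V) (M : V → V → Prop) : Prop where
  left : ∀ {u v}, M u v → IsLeft G x y u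
  right : ∀ {u v}, M u v → IsRight G x y v
  adj : ∀ {u v}, M u v → u = v ∨ G.Adj u v
  left_unique : ∀ {u u' v}, M u v → M u' v → u = u'
  right_unique : ∀ {u v v'}, M u v → M u v' → v = v'

namespace AuxMatching

variable {M : V → V → Prop}

theorem no_pred (hM : AuxMatching G x y M) {a u : V} (ha : G.Adj x a) : ¬ M u a :=
  fun h => (hM.right h).2.2 ha

/-- The orbits of different neighbours of `x` are disjoint. -/
theorem orbit_disjoint (hM : AuxMatching G x y M) {a b v : V} (ha : G.Adj x a) (hb : G.Adj x b)
    (hav : Relation.ReflTransGen M a v) (hbv : Relation.ReflTransGen M b v) : a = b := by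
  -- Walk back along the unique predecessors; neither `a` nor `b` has one, so both walks stop
  -- together.
  induction hav with
  | refl =>
    rcases hbv.cases_tail with h | ⟨u, _, h⟩
    · exact h
    · exact (hM.no_pred ha h).elim
  | @tail u v _ huv ih =>
    rcases hbv.cases_tail with h | ⟨u', h', h⟩
    · exact (hM.no_pred hb (h ▸ huv)).elim
    · exact ih (hM.left_unique huv h ▸ h')

/-- The orbit of a neighbour of `x` ends. -/
theorem exists_terminal [Finite V] (hM : AuxMatching G x y M) {a : V} (ha : G.Adj x a) :
    ∃ t, Relation.ReflTransGen M a t ∧ ∀ v, ¬ M t v := by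
  -- Otherwise the successor map is an injection of the finite orbit into itself, hence surjective,
  -- and `a` would have a predecessor.
  by_contra! hcon
  choose! g hg using hcon
  let W := {v // Relation.ReflTransGen M a v}
  let f : W → W := fun w => ⟨g w, w.2.tail (hg w w.2)⟩
  have hf : Function.Injective f := fun w w' h => by
    have h' : g w = g w' := congrArg Subtype.val h
    exact Subtype.ext (hM.left_unique (hg w w.2) (h' ▸ hg w' w'.2))
  obtain ⟨w, hw⟩ := Finite.injective_iff_surjective.mp hf ⟨a, .refl⟩
  have h' : g w = a := congrArg Subtype.val hw
  exact hM.no_pred ha (h' ▸ hg w w.2)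

/-- The subgraph spanned by the orbit of a neighbour `a` of `x`, together with `x` and `y`. -/
def orbitSubdigraph (G : SimpleGraph V) (x y : V) (M : V → V → Prop) (a : V) :
    G.completeBiorientation.Subdigraph where
  verts := {v | v = x ∨ v = y ∨ Relation.ReflTransGen M a v}
  Adj u v := G.Adj u v ∧ (u = x ∨ u = y ∨ Relation.ReflTransGen M a u) ∧
    (v = x ∨ v = y ∨ Relation.ReflTransGen M a v) ∧
    -- The arcs between `x` and `y` are reserved for the orbit starting at `y`; otherwise different
    -- orbits could share them.
    (a = y ∨ ¬ ((u = x ∨ u = y) ∧ (v = x ∨ v = y)))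
  adj_sub h := h.1
  fst_mem h := h.2.1
  snd_mem h := h.2.2.1

theorem orbit_ne (hM : AuxMatching G x y M) {a v : V} (ha : G.Adj x a) (hay : a ≠ y)
    (hav : Relation.ReflTransGen M a v) : v ≠ x ∧ v ≠ y := by
  rcases hav.cases_tail with h | ⟨u, _, h⟩
  · subst h
    exact ⟨ha.ne', hay⟩
  · exact ⟨(hM.right h).1, (hM.right h).2.1⟩

/-- The arc relation is symmetric, so it is enough to reach everything from `x`. A step of `M` is an
edge or no move at all, which carries `x` through the orbit, and `b` gives access to `y`. -/
theorem orbitSubdigraph_isStrong (hM : AuxMatching G x y M) {a : V} (ha : G.Adj x a)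
    (hay : a = y ∨ ∃ b, Relation.ReflTransGen M a b ∧ G.Adj b y) :
    (orbitSubdigraph G x y M a).IsStrong := by
  set H := orbitSubdigraph G x y M a with hH
  have hsymm : Std.Symm H.Adj := ⟨fun u v h =>
    ⟨h.1.symm, h.2.2.1, h.2.1, h.2.2.2.imp_right fun h' h'' => h' h''.symm⟩⟩
  have h0 : Relation.ReflTransGen H.Adj x a := by
    refine .single ⟨ha, Or.inl rfl, Or.inr (Or.inr .refl), ?_⟩
    have := ha.ne'
    tauto
  have horb : ∀ v, Relation.ReflTransGen M a v → Relation.ReflTransGen H.Adj x v := by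
    intro v hv
    induction hv with
    | refl => exact h0
    | @tail u v hau huv ih =>
      rcases hM.adj huv with h | h
      · exact h ▸ ih
      · refine ih.tail ⟨h, Or.inr (Or.inr hau), Or.inr (Or.inr (hau.tail huv)), Or.inr ?_⟩
        have := hM.right huv
        exact fun h' => h'.2.elim this.1 this.2.1
  have hx : ∀ v ∈ H.verts, Relation.ReflTransGen H.Adj x v := by
    rintro v (rfl | rfl | hv)
    · exact .refl
    · rcases hay with rfl | ⟨b, hb, hby⟩
      · exact h0
      · by_cases hav : a = v
        · exact hav ▸ h0
        · refine (horb b hb).tail ⟨hby, Or.inr (Or.inr hb), Or.inr (Or.inl rfl), Or.inr ?_⟩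
          have := hM.orbit_ne ha hav hb
          exact fun h' => h'.1.elim this.1 this.2
    · exact horb v hv
  refine ⟨⟨x, Or.inl rfl⟩, fun u hu v hv => ?_⟩
  exact (Relation.ReflTransGen.stdSymm.symm _ _ (hx u hu)).trans (hx v hv)

open Classical in
/-- A matching with few uncovered left vertices provides many strong subgraphs. -/
theorem hasInternallyDisjointStrong [Fintype V] [DecidableEq V] (hM : AuxMatching G x y M) {p : ℕ}
    (hp : p + (Finset.univ.filter fun u => IsLeft G x y u ∧ ∀ v, ¬ M u v).card ≤
      (Finset.univ.filter fun a => G.Adj x a).card) :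
    G.completeBiorientation.HasInternallyDisjointStrong {x, y} p := by
  set A := Finset.univ.filter fun a => G.Adj x a
  set B := Finset.univ.filter fun u => IsLeft G x y u ∧ ∀ v, ¬ M u v
  set good : V → Prop := fun a => a = y ∨ ∃ b, Relation.ReflTransGen M a b ∧ G.Adj b y
  -- The end of a bad orbit is not adjacent to `y`, hence an uncovered left vertex, and disjoint
  -- orbits have different ends.
  have hbad : (A.filter fun a => ¬ good a).card ≤ B.card := by
    have ht : ∀ a ∈ A.filter fun a => ¬ good a, ∃ t ∈ B, Relation.ReflTransGen M a t := by
      intro a ha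
      obtain ⟨ha, hg⟩ := Finset.mem_filter.mp ha
      replace ha : G.Adj x a := (Finset.mem_filter.mp ha).2
      obtain ⟨t, hat, ht⟩ := hM.exists_terminal ha
      simp only [good, not_or, not_exists, not_and] at hg
      have := hM.orbit_ne ha hg.1 hat
      exact ⟨t, Finset.mem_filter.mpr ⟨Finset.mem_univ _,
        ⟨this.1, this.2, fun h => hg.2 t hat h.symm⟩, ht⟩, hat⟩
    choose! f hf hf' using ht
    refine Finset.card_le_card_of_injOn f (fun a ha => hf a ha) ?_
    intro a ha b hb hab
    have ha' := hf' a ha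
    have hb' := hf' b hb
    have h1 : G.Adj x a := (Finset.mem_filter.mp (Finset.mem_filter.mp ha).1).2
    have h2 : G.Adj x b := (Finset.mem_filter.mp (Finset.mem_filter.mp hb).1).2
    exact hM.orbit_disjoint h1 h2 ha' (hab ▸ hb')
  have hcard := Finset.card_filter_add_card_filter_not (s := A) good
  refine Digraph.hasInternallyDisjointStrong_of_finset (A.filter good)
    (orbitSubdigraph G x y M) ?_ ?_ (by omega)
  · intro a ha
    obtain ⟨ha, hg⟩ := Finset.mem_filter.mp ha
    refine ⟨hM.orbitSubdigraph_isStrong (Finset.mem_filter.mp ha).2 hg, ?_⟩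
    intro v hv
    have : v = x ∨ v = y := by simpa using hv
    exact this.elim Or.inl fun h => Or.inr (Or.inl h)
  · intro a ha b hb hab
    have h1 : G.Adj x a := (Finset.mem_filter.mp (Finset.mem_filter.mp ha).1).2
    have h2 : G.Adj x b := (Finset.mem_filter.mp (Finset.mem_filter.mp hb).1).2
    have hd := fun v h h' => hab (hM.orbit_disjoint (v := v) h1 h2 h h')
    have hS : ∀ v, (v = x ∨ v = y ∨ Relation.ReflTransGen M a v) →
        (v = x ∨ v = y ∨ Relation.ReflTransGen M b v) → v = x ∨ v = y := by
      intro v h h'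
      have := hd v
      tauto
    constructor
    · ext v
      simp only [orbitSubdigraph, Set.mem_inter_iff, Set.mem_ofPred_eq, Finset.coe_insert,
        Finset.coe_singleton, Set.mem_insert_iff, Set.mem_singleton_iff]
      have := hS v
      tauto
    · rintro u v ⟨h, h'⟩
      have hu := hS u h.2.1 h'.2.1
      have hv := hS v h.2.2.1 h'.2.2.1
      have ha := h.2.2.2
      have hb := h'.2.2.2
      have : a = y := by tauto
      have : b = y := by tauto
      exact hab (by simp [*])

end AuxMatching

/-! ### Separators and the duality with prices -/

open Classical in
/-- A set of vertices which separates `x` from `y`, up to the edge between them, bounds the number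
of internally disjoint strong subgraphs. -/
theorem card_le_of_separator [DecidableEq V] {X C : Finset V} (hxy : x ≠ y)
    (hxC : x ∉ C) (hyC : y ∉ C) (hyX : y ∉ X)
    (hX : ∀ u v, (u = x ∨ u ∈ X) → G.Adj u v → v = x ∨ v ∈ X ∨ v ∈ C ∨ u = x ∧ v = y) {p : ℕ}
    (hp : G.completeBiorientation.HasInternallyDisjointStrong {x, y} p) :
    p ≤ C.card + if G.Adj x y then 1 else 0 := by
  obtain ⟨H, h1, h2⟩ := hp
  -- A subgraph that avoids `C` and the arc from `x` to `y` cannot leave `{x} ∪ X`, which does not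
  -- contain `y`.
  have key : ∀ i, (∃ v ∈ C, v ∈ (H i).verts) ∨ (H i).Adj x y := by
    intro i
    by_contra! hcon
    have hcl : ∀ v, Relation.ReflTransGen (H i).Adj x v → v = x ∨ v ∈ X := by
      intro v hv
      induction hv with
      | refl => exact Or.inl rfl
      | @tail u v _ huv ih =>
        rcases hX u v ih ((H i).adj_sub huv) with h | h | h | ⟨rfl, rfl⟩
        · exact Or.inl h
        · exact Or.inr h
        · exact (hcon.1 v h ((H i).snd_mem huv)).elim
        · exact (hcon.2 huv).elim
    have hy := hcl y ((h1 i).1.2 x ((h1 i).2 (by simp)) y ((h1 i).2 (by simp)))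
    exact hy.elim (fun h => hxy h.symm) hyX
  have h2' : ∀ i j, i ≠ j → (H i).verts ∩ (H j).verts = (({x, y} : Finset V) : Set V) ∧
      ∀ u v, ¬ ((H i).Adj u v ∧ (H j).Adj u v) := by
    intro i j hij
    rcases lt_or_gt_of_ne hij with h | h
    · exact h2 i j h
    · obtain ⟨ha, hb⟩ := h2 j i h
      exact ⟨by rw [Set.inter_comm, ha], fun u v h => hb u v h.symm⟩
  have hA : (Finset.univ.filter fun i => (H i).Adj x y).card ≤ if G.Adj x y then 1 else 0 := by
    split_ifs with h
    · refine Finset.card_le_one.mpr fun i hi j hj => ?_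
      by_contra hij
      exact (h2' i j hij).2 x y ⟨(Finset.mem_filter.mp hi).2, (Finset.mem_filter.mp hj).2⟩
    · simp only [Nat.le_zero, Finset.card_eq_zero, Finset.filter_eq_empty_iff]
      exact fun i _ hi => h ((H i).adj_sub hi)
  have hne : Nonempty V := ⟨x⟩
  have hC : (Finset.univ.filter fun i => ¬ (H i).Adj x y).card ≤ C.card := by
    have : ∀ i ∈ Finset.univ.filter fun i => ¬ (H i).Adj x y, ∃ v ∈ C, v ∈ (H i).verts :=
      fun i hi => (key i).resolve_right (Finset.mem_filter.mp hi).2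
    choose! f hf hf' using this
    refine Finset.card_le_card_of_injOn f (fun i hi => hf i hi) fun i hi j hj hij => ?_
    by_contra hne
    have hm : f i ∈ (H i).verts ∩ (H j).verts := ⟨hf' i hi, hij ▸ hf' j hj⟩
    rw [(h2' i j hne).1] at hm
    have : f i = x ∨ f i = y := by simpa using hm
    rcases this with h | h
    · exact hxC (h ▸ hf i hi)
    · exact hyC (h ▸ hf i hi)
  have hcard := Finset.card_filter_add_card_filter_not (s := (Finset.univ : Finset (Fin p)))
    fun i => (H i).Adj x y
  rw [Finset.card_univ, Fintype.card_fin] at hcard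
  omega

open Classical in
/-- If there are prices for the right vertices at which every left vertex has, up to `1`, the
cheapest of its neighbours, or cannot afford any of them, then the matching is optimal. -/
theorem AuxMatching.card_le_of_prices [Fintype V] [DecidableEq V] {M : V → V → Prop}
    (hM : AuxMatching G x y M) (hxy : x ≠ y)
    (price : V → ℕ)
    (hcheap : ∀ u v v', M u v → IsRight G x y v' → u = v' ∨ G.Adj u v' → price v ≤ price v' + 1)
    (hfree : ∀ v, IsRight G x y v → 0 < price v → ∃ u, M u v)
    (hleft : ∀ u v, IsLeft G x y u → (∀ w, ¬ M u w) → IsRight G x y v → u = v ∨ G.Adj u v →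
      Fintype.card V ≤ price v)
    {p : ℕ} (hp : G.completeBiorientation.HasInternallyDisjointStrong {x, y} p) :
    p + (Finset.univ.filter fun u => IsLeft G x y u ∧ ∀ v, ¬ M u v).card ≤
      (Finset.univ.filter fun a => G.Adj x a).card := by
  -- a value below the number of vertices which is not a price
  obtain ⟨j, hjV, hj⟩ : ∃ j < Fintype.card V, ∀ v, IsRight G x y v → price v ≠ j := by
    by_contra! hcon
    -- Pigeonhole: `x` is not a right vertex, so right vertices show at most `|V| - 1` prices.
    have hsub : Finset.range (Fintype.card V) ⊆ (Finset.univ.erase x).image price := by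
      intro j hj
      obtain ⟨v, hv, rfl⟩ := hcon j (Finset.mem_range.mp hj)
      exact Finset.mem_image_of_mem _ (Finset.mem_erase.mpr ⟨hv.1, Finset.mem_univ _⟩)
    have h1 := (Finset.card_le_card hsub).trans Finset.card_image_le
    rw [Finset.card_range, Finset.card_erase_of_mem (Finset.mem_univ x), Finset.card_univ] at h1
    have : 0 < Fintype.card V := Fintype.card_pos_iff.mpr ⟨x⟩
    omega
  set B := Finset.univ.filter fun u => IsLeft G x y u ∧ ∀ v, ¬ M u v with hB
  set T := Finset.univ.filter fun v => IsRight G x y v ∧ j < price v with hT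
  have hm : ∀ v ∈ T, ∃ u, M u v := fun v hv => by
    have := (Finset.mem_filter.mp hv).2
    exact hfree v this.1 (by omega)
  choose! g hg using hm
  -- The Hall violator: the uncovered left vertices and the partners of the expensive right
  -- vertices. All its neighbours will lie in `T`, while `|X| = |B| + |T|`.
  set X := B ∪ T.image g with hX
  set A := Finset.univ.filter fun a => G.Adj x a ∧ a ≠ y with hA
  have hXcard : X.card = B.card + T.card := by
    rw [hX, Finset.card_union_of_disjoint, Finset.card_image_of_injOn]
    · intro v hv w hw hvw
      exact hM.right_unique (hg v hv) (hvw ▸ hg w hw)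
    · rw [Finset.disjoint_left]
      intro u hu hu'
      obtain ⟨v, hv, rfl⟩ := Finset.mem_image.mp hu'
      exact (Finset.mem_filter.mp hu).2.2 v (hg v hv)
  have hXleft : ∀ u ∈ X, IsLeft G x y u := by
    intro u hu
    rcases Finset.mem_union.mp hu with h | h
    · exact (Finset.mem_filter.mp h).2.1
    · obtain ⟨v, hv, rfl⟩ := Finset.mem_image.mp h
      exact hM.left (hg v hv)
  have hXT : ∀ u ∈ X, ∀ v, IsRight G x y v → u = v ∨ G.Adj u v → v ∈ T := by
    intro u hu v hv huv
    refine Finset.mem_filter.mpr ⟨Finset.mem_univ _, hv, ?_⟩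
    rcases Finset.mem_union.mp hu with h | h
    · have := (Finset.mem_filter.mp h).2
      exact hjV.trans_le (hleft u v this.1 this.2 hv huv)
    · obtain ⟨w, hw, rfl⟩ := Finset.mem_image.mp h
      have h1 := hcheap _ w v (hg w hw) hv huv
      -- The partner of `w` has only neighbours of price at least `price w - 1 ≥ j`; since `j` is
      -- not a price, they cost more than `j`.
      have h2 := (Finset.mem_filter.mp hw).2.2
      have h3 := hj v hv
      omega
  have hdisj : Disjoint A T := by
    rw [Finset.disjoint_left]
    intro a ha ha'
    exact (Finset.mem_filter.mp ha').2.1.2.2 (Finset.mem_filter.mp ha).2.1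
  -- A left vertex not adjacent to `x` is also a right vertex and its own neighbour, so it falls
  -- into `T`.
  have hXAT : X ⊆ A ∪ T := by
    intro u hu
    have hl := hXleft u hu
    by_cases h : G.Adj x u
    · exact Finset.mem_union_left _ (Finset.mem_filter.mpr ⟨Finset.mem_univ _, h, hl.2.1⟩)
    · exact Finset.mem_union_right _ (hXT u hu u ⟨hl.1, hl.2.1, h⟩ (Or.inl rfl))
  have hC := Finset.card_sdiff_add_card_eq_card hXAT
  rw [Finset.card_union_of_disjoint hdisj] at hC
  have hAmem : ∀ a, a ∈ A ↔ G.Adj x a ∧ a ≠ y := fun a => by simp [hA]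
  -- This separator has `|A| + |T| - |X| = |A| - |B|` vertices. A neighbour of `X` other than `x`
  -- cannot be `y`; it is in `A` if adjacent to `x`, and otherwise is a right vertex, hence in `T`.
  have hsep := card_le_of_separator (G := G) (X := X) (C := (A ∪ T) \ X) hxy
    (fun h => by
      rcases Finset.mem_union.mp (Finset.mem_sdiff.mp h).1 with h | h
      · exact ((hAmem x).mp h).1.ne rfl
      · exact (Finset.mem_filter.mp h).2.1.1 rfl)
    (fun h => by
      rcases Finset.mem_union.mp (Finset.mem_sdiff.mp h).1 with h | h
      · exact ((hAmem y).mp h).2 rfl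
      · exact (Finset.mem_filter.mp h).2.1.2.1 rfl)
    (fun h => (hXleft y h).2.1 rfl) (by
      intro u v hu huv
      by_cases hvX : v ∈ X
      · exact Or.inr (Or.inl hvX)
      by_cases hvx : v = x
      · exact Or.inl hvx
      by_cases hvA : v ∈ A
      · exact Or.inr (Or.inr (Or.inl (by simp [hvA, hvX])))
      rw [hAmem] at hvA
      rcases hu with rfl | hu
      · exact Or.inr (Or.inr (Or.inr ⟨rfl, by tauto⟩))
      · have hvy : v ≠ y := by
          rintro rfl
          exact (hXleft u hu).2.2 huv.symm
        have := hXT u hu v ⟨hvx, hvy, by tauto⟩ (Or.inr huv)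
        exact Or.inr (Or.inr (Or.inl (by simp [this, hvX])))) hp
  have hdeg : (Finset.univ.filter fun a => G.Adj x a).card =
      A.card + if G.Adj x y then 1 else 0 := by
    rw [← Finset.card_filter_add_card_filter_not (s := Finset.univ.filter fun a => G.Adj x a)
      fun a => a ≠ y, Finset.filter_filter, Finset.filter_filter]
    congr 1
    split_ifs with h
    · rw [Finset.card_eq_one]
      refine ⟨y, ?_⟩
      ext a
      simp only [Finset.mem_filter, Finset.mem_univ, true_and, not_not, Finset.mem_singleton]
      exact ⟨fun h => h.2, fun h' => ⟨h' ▸ h, h'⟩⟩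
    · rw [Finset.card_eq_zero, Finset.filter_eq_empty_iff]
      rintro a - ⟨h1, h2⟩
      exact h (not_not.mp h2 ▸ h1)
  omega

end TwoVertices

/-! ### The auction -/

section Auction

variable {n : ℕ} {G : SimpleGraph (Fin n)} {x y : Fin n} {p o s : ℕ → ℕ}

/-- The state of an auction: `p v` is the price of the vertex `v`, `o v` is `u + 1` if `v` is
assigned to the left vertex `u`, and `0` if it is not assigned, and `s (u + 1)` is `0` if `u` is an
unassigned left vertex. Vertices that are not on the right have a prohibitive price. -/
structure AuctionState (G : SimpleGraph (Fin n)) (x y : Fin n) (p o s : ℕ → ℕ) : Prop where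
  price_le : ∀ v : Fin n, p v ≤ n
  price_eq : ∀ v : Fin n, ¬ IsRight G x y v → p v = n
  price_free : ∀ v : Fin n, IsRight G x y v → o v = 0 → p v = 0
  right : ∀ v : Fin n, o v ≠ 0 → IsRight G x y v
  owner : ∀ v : Fin n, o v ≠ 0 → ∃ u : Fin n, o v = u + 1 ∧ IsLeft G x y u ∧
    (u = v ∨ G.Adj u v) ∧ ∀ v' : Fin n, u = v' ∨ G.Adj u v' → p v ≤ p v' + 1
  inj : ∀ v v' : Fin n, o v ≠ 0 → o v = o v' → v = v'
  active : ∀ u : Fin n, s (u + 1) = 0 ↔ IsLeft G x y u ∧ ∀ v : Fin n, o v ≠ u + 1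

/-- No left vertex bids any more. -/
def AuctionOver (G : SimpleGraph (Fin n)) (p s : ℕ → ℕ) : Prop :=
  ∀ u : Fin n, s (u + 1) = 0 → ∀ v : Fin n, u = v ∨ G.Adj u v → n ≤ p v

/-- An unassigned left vertex bids for a cheapest neighbour. -/
theorem AuctionState.bid (h : AuctionState G x y p o s) {u v : Fin n} (hu : s (u + 1) = 0)
    (huv : u = v ∨ G.Adj u v) (hv : p v < n)
    (hmin : ∀ v' : Fin n, u = v' ∨ G.Adj u v' → p v ≤ p v') :
    AuctionState G x y (Function.update p v (p v + 1)) (Function.update o v (u + 1))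
      (Function.update (Function.update s (o v) 0) (u + 1) 1) := by
  obtain ⟨hL, hun⟩ := (h.active u).mp hu
  have hR : IsRight G x y v := by
    by_contra hR
    exact hv.ne (h.price_eq v hR)
  -- Prices only rise, so the other owners' bounds survive.
  have hle : ∀ w : Fin n, p w ≤ Function.update p v (p v + 1) w := by
    intro w
    rw [Function.update_apply]
    split_ifs with e
    · rw [e]; omega
    · exact le_rfl
  have hne : ∀ {w : Fin n}, w ≠ v → (w : ℕ) ≠ v := fun hw e => hw (Fin.ext e)
  refine ⟨?_, ?_, ?_, ?_, ?_, ?_, ?_⟩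
  · intro w
    rw [Function.update_apply]
    split_ifs
    · omega
    · exact h.price_le w
  · intro w hw
    rw [Function.update_of_ne (hne (w := w) fun e => hw (e ▸ hR))]
    exact h.price_eq w hw
  · intro w hw how
    by_cases e : w = v
    · simp [e] at how
    · rw [Function.update_of_ne (hne e)] at how ⊢
      exact h.price_free w hw how
  · intro w how
    by_cases e : w = v
    · exact e ▸ hR
    · rw [Function.update_of_ne (hne e)] at how
      exact h.right w how
  · intro w how
    by_cases e : w = v
    · subst e
      refine ⟨u, by simp, hL, huv, fun v' hv' => ?_⟩
      rw [Function.update_self]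
      exact Nat.succ_le_succ ((hmin v' hv').trans (hle v'))
    · rw [Function.update_of_ne (hne e)] at how ⊢
      rw [Function.update_of_ne (hne e)]
      obtain ⟨u', h1, h2, h3, h4⟩ := h.owner w how
      exact ⟨u', h1, h2, h3, fun v' hv' => (h4 v' hv').trans (Nat.succ_le_succ (hle v'))⟩
  · intro w w' how hww
    by_cases e : w = v
    · by_cases e' : w' = v
      · rw [e, e']
      · rw [e, Function.update_self, Function.update_of_ne (hne e')] at hww
        exact (hun w' hww.symm).elim
    · rw [Function.update_of_ne (hne e)] at how hww
      by_cases e' : w' = v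
      · rw [e', Function.update_self] at hww
        exact (hun w hww).elim
      · rw [Function.update_of_ne (hne e')] at hww
        exact h.inj w w' how hww
  -- The bidder becomes inactive and the evicted owner active. If `v` had no owner, then `o v = 0`
  -- and the reset hits position `0`, which is no vertex's flag; this is what the shift by one is
  -- for.
  · intro w
    by_cases e : w = u
    · subst e
      simp only [Function.update_self, one_ne_zero, false_iff, not_and]
      exact fun _ hw => hw v (by simp)
    · have e1 : (w : ℕ) + 1 ≠ u + 1 := fun h' => e (Fin.ext (by omega))
      rw [Function.update_of_ne e1]
      by_cases e2 : (w : ℕ) + 1 = o v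
      · rw [e2, Function.update_self]
        have how : o v ≠ 0 := by omega
        obtain ⟨u', h1, h2, _⟩ := h.owner v how
        have : w = u' := Fin.ext (by omega)
        refine ⟨fun _ => ⟨this ▸ h2, fun v' => ?_⟩, fun _ => rfl⟩
        by_cases e3 : v' = v
        · rw [e3, Function.update_self]
          omega
        · rw [Function.update_of_ne (hne e3)]
          exact fun h' => e3 (h.inj v v' how h'.symm).symm
      · rw [Function.update_of_ne e2, h.active w]
        refine and_congr_right fun _ => forall_congr' fun v' => ?_
        by_cases e3 : v' = v
        · rw [e3, Function.update_self]
          exact ⟨fun _ => by omega, fun _ => fun h' => e2 h'.symm⟩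
        · rw [Function.update_of_ne (hne e3)]

/-- When the auction is over, the number of unassigned left vertices tells the local
connectivity. -/
theorem AuctionState.localStrongConnectivity (h : AuctionState G x y p o s)
    (hover : AuctionOver G p s) (hxy : x ≠ y) [DecidableRel G.Adj] :
    G.completeBiorientation.localStrongConnectivity {x, y} +
      (Finset.univ.filter fun u : Fin n => s (u + 1) = 0).card =
      (Finset.univ.filter fun a => G.Adj x a).card := by
  classical
  have hM : AuxMatching G x y fun u v : Fin n => o v = u + 1 := by
    have ho : ∀ {u v : Fin n}, o v = u + 1 → IsLeft G x y u ∧ (u = v ∨ G.Adj u v) := by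
      intro u v huv
      obtain ⟨u', h1, h2, h3, _⟩ := h.owner v (by omega)
      have : u = u' := Fin.ext (by omega)
      exact this ▸ ⟨h2, h3⟩
    exact
      { left := fun h' => (ho h').1
        right := fun h' => h.right _ (by omega)
        adj := fun h' => (ho h').2
        left_unique := fun h1 h2 => Fin.ext (by omega)
        right_unique := fun h1 h2 => h.inj _ _ (by omega) (h1.trans h2.symm) }
  have hact : (Finset.univ.filter fun u : Fin n => s (u + 1) = 0) =
      Finset.univ.filter fun u : Fin n => IsLeft G x y u ∧ ∀ v : Fin n, ¬ o v = u + 1 :=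
    Finset.filter_congr fun u _ => h.active u
  have hS : 2 ≤ ({x, y} : Finset (Fin n)).card := (Finset.card_pair hxy).ge
  have hgreat := G.completeBiorientation.isGreatest_localStrongConnectivity _ hS
  have hupper : ∀ {k : ℕ}, G.completeBiorientation.HasInternallyDisjointStrong {x, y} k →
      k + (Finset.univ.filter fun u : Fin n => s (u + 1) = 0).card ≤
        (Finset.univ.filter fun a => G.Adj x a).card := by
    intro k hk
    rw [hact]
    convert hM.card_le_of_prices hxy (fun v => p v) ?_ ?_ ?_ hk
    · intro u v v' huv hv' huv'
      obtain ⟨u', h1, _, _, h4⟩ := h.owner v (by omega)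
      have : u = u' := Fin.ext (by omega)
      exact h4 v' (this ▸ huv')
    · intro v hv hpv
      obtain ⟨u, hu, _⟩ := h.owner v fun h' => hpv.ne' (h.price_free v hv h')
      exact ⟨u, hu⟩
    · intro u v hu hun _ huv
      rw [Fintype.card_fin]
      exact hover u ((h.active u).mpr ⟨hu, hun⟩) v huv
  have h0 := hupper hgreat.1
  refine le_antisymm h0 ?_
  -- By `h0` the number of unassigned vertices is at most the degree, so the truncated difference is
  -- exact.
  have := hgreat.2 (hM.hasInternallyDisjointStrong
    (p := (Finset.univ.filter fun a => G.Adj x a).card -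
      (Finset.univ.filter fun u : Fin n => s (u + 1) = 0).card) (by
        rw [hact] at h0 ⊢
        have e := Nat.sub_add_cancel (le_of_add_le_right h0)
        refine le_of_eq ?_
        convert e))
  omega

end Auction

/-! ### The program -/

namespace RAM

open Cmd

/-- Inner subprograms mostly write to higher registers than the code around them, so one threshold,
checked by evaluation, protects the outer data. -/
theorem Cmd.eval_reg_of_lt {c : Cmd} (b : ℕ) (h : c.writes.all (b ≤ ·) = true) {q : ℕ}
    (hq : q < b) (s : Store) : (c.eval s).reg q = s.reg q := by
  refine eval_reg (fun hm => ?_) s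
  have := List.all_eq_true.mp h q hm
  simp only [decide_eq_true_eq] at this
  omega

/-- Set register `r` to `1 + n * i`, where `n` is the content of register `1`, and `i` that of
register `a`. -/
def rowBase (r a : ℕ) : Cmd :=
  .seq (.const r 1) (.loop 16 (.add r r a))

/-- Set register `r` to `1` if the registers `a` and `b` agree, and to `0` otherwise. -/
def isEq (r a b : ℕ) : Cmd :=
  .seq (.sub r a b) (.seq (.sub 22 b a) (.seq (.add r r 22) (.sub r 3 r)))

/-- Compare the vertex in register `19` with the cheapest neighbour found so far. -/
def scanStep : Cmd :=
  .seq (isEq 20 14 19) (.seq (.add 21 15 19) (.seq (.load 21 21) (.seq (.add 20 20 21)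
    (.ite 20 (.seq (.add 21 4 19) (.seq (.load 22 21) (.seq (.sub 20 17 22)
      (.ite 20 (.seq (.add 17 22 2) (.add 18 21 2)) .skip)))) .skip))))

/-- Find a cheapest neighbour of the vertex in register `14`. -/
def scan : Cmd :=
  .seq (.const 18 0) (.seq (.add 17 1 2) (.loop 19 scanStep))

/-- Assign the vertex found by `scan`. -/
def assign : Cmd :=
  .seq (.add 17 17 3) (.seq (.store 18 17) (.seq (.add 18 18 1) (.seq (.load 21 18)
    (.seq (.add 21 6 21) (.seq (.store 21 2) (.seq (.add 21 14 3) (.seq (.store 18 21)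
      (.seq (.add 21 6 21) (.store 21 3)))))))))

/-- The bid of the vertex in register `14`. -/
def bid : Cmd :=
  .seq (.add 21 6 14) (.seq (.add 21 21 3) (.seq (.load 22 21) (.ite 22 .skip
    (.seq (rowBase 15 14) (.seq scan (.seq (.sub 20 1 17) (.ite 20 assign .skip)))))))

/-- Start the auction for the vertices in the registers `7` and `8`, at the vertex in
register `14`. -/
def initStep : Cmd :=
  .seq (isEq 20 14 7) (.seq (isEq 21 14 8) (.seq (.add 20 20 21)
    (.seq (.add 21 9 14) (.seq (.load 21 21) (.seq (.add 21 20 21)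
    (.seq (.ite 21 (.add 21 1 2) .skip) (.seq (.add 22 4 14) (.seq (.store 22 21)
    (.seq (.add 22 5 14) (.seq (.store 22 2)
    (.seq (.add 21 10 14) (.seq (.load 21 21) (.seq (.add 21 20 21)
    (.seq (.add 22 6 14) (.seq (.add 22 22 3) (.store 22 21))))))))))))))))

/-- Start the auction for the vertices in the registers `7` and `8`. -/
def initArrays : Cmd := .loop 14 initStep

/-- Update the degree in register `23` and the number of active vertices in register `24`. -/
def countStep : Cmd :=
  .seq (.add 21 9 14) (.seq (.load 21 21) (.seq (.add 23 23 21)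
    (.seq (.add 21 6 14) (.seq (.add 21 21 3) (.seq (.load 21 21) (.seq (.sub 21 3 21)
      (.add 24 24 21)))))))

/-- Compute the degree of the vertex in register `7` and the number of active vertices. -/
def count : Cmd :=
  .seq (.const 23 0) (.seq (.const 24 0) (.loop 14 countStep))

/-- Carry out all rounds of the auction. -/
def auction : Cmd := .loop 11 (.loop 12 (.loop 13 (.loop 14 bid)))

/-- Compute the local connectivity of the vertices in the registers `7` and `8`. -/
def localConn : Cmd :=
  .seq (rowBase 9 7) (.seq (rowBase 10 8) (.seq initArrays (.seq auction
    (.seq count (.sub 23 23 24)))))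

/-- Update the minimum in register `0` by the local connectivity of the vertices in the registers
`7` and `8`. -/
def pairStep : Cmd :=
  .seq (isEq 20 7 8) (.ite 20 .skip
    (.seq localConn (.seq (.sub 24 0 23) (.ite 24 (.add 0 23 2) .skip))))

/-- Compute the minimum of the local connectivities. -/
def main : Cmd :=
  .seq (rowBase 4 1) (.seq (.add 5 4 1) (.seq (.add 6 5 1) (.seq (.add 0 1 2)
    (.loop 7 (.loop 8 pairStep)))))

/-! ### Values of the elementary subprograms -/

theorem rowBase_eval {r a : ℕ} (hr : r ≠ 16) (ha : a ≠ 16) (har : a ≠ r) (h1 : r ≠ 1)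
    (s : Store) : ((rowBase r a).eval s).reg r = 1 + s.reg 1 * s.reg a := by
  have key : ∀ (k : ℕ) (s' : Store), (countdown (Cmd.add r r a).eval 16 k s').reg r =
      s'.reg r + k * s'.reg a := by
    intro k
    induction k with
    | zero => intro s'; simp [countdown, Store.set_reg, hr]
    | succ k ih =>
      intro s'
      rw [countdown, ih]
      simp only [eval, Store.set_reg, hr, ha, har, if_true, if_false]
      ring
  rw [rowBase, eval, eval, eval, key]
  simp [Store.set_reg, har, h1.symm]

/-- The two truncated differences add up to the absolute difference, and subtracting that from `1`,
again truncated, tests whether it vanishes. -/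
theorem isEq_eval {r a b : ℕ} (ha : a ≠ r) (hb : b ≠ r) (hr : r ≠ 22) (hr3 : r ≠ 3) (s : Store) (h3 : s.reg 3 = 1) :
    ((isEq r a b).eval s).reg r = if s.reg a = s.reg b then 1 else 0 := by
  simp [isEq, eval, Store.set_reg, ha, hb, hr, hr3.symm, h3]
  split_ifs <;> omega

theorem isEq_reg {r a b q : ℕ} (h1 : q ≠ r) (h2 : q ≠ 22) (s : Store) :
    ((isEq r a b).eval s).reg q = s.reg q :=
  eval_reg (by simp [isEq, writes, h1, h2]) _

theorem isEq_mem {r a b : ℕ} (s : Store) : ((isEq r a b).eval s).mem = s.mem :=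
  eval_mem rfl _

/-- `c` adds the equality test to the matrix entry, so it is nonzero exactly for neighbours in the
auxiliary graph. Register `18` keeps the address of the price cell, not the vertex. -/
theorem scanStep_eval (s : Store) (h2 : s.reg 2 = 0) (h3 : s.reg 3 = 1) {c p : ℕ}
    (hc : (if s.reg 14 = s.reg 19 then 1 else 0) + s.mem (s.reg 15 + s.reg 19) = c)
    (hp : s.mem (s.reg 4 + s.reg 19) = p) :
    (scanStep.eval s).reg 17 = (if c ≠ 0 ∧ p < s.reg 17 then p else s.reg 17) ∧
    (scanStep.eval s).reg 18 =
      if c ≠ 0 ∧ p < s.reg 17 then s.reg 4 + s.reg 19 else s.reg 18 := by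
  have e := isEq_eval (r := 20) (a := 14) (b := 19) (by decide) (by decide)
    (by decide) (by decide) s h3
  have e' := fun q h1 h2 => isEq_reg (r := 20) (a := 14) (b := 19) (q := q) h1 h2 s
  have em := isEq_mem (r := 20) (a := 14) (b := 19) s
  simp only [scanStep, eval]
  generalize (isEq 20 14 19).eval s = s1 at e e' em
  simp only [Store.set_reg, Store.set_mem, em]
  simp [e, e', hc, hp, h2]
  by_cases h : c = 0
  · simp [h, Store.set_reg, e']
  · by_cases h' : p < s.reg 17
    · simp [h, h', not_le.mpr h', Store.set_reg, Nat.sub_eq_zero_iff_le]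
    · simp [h, h', not_lt.mp h', Store.set_reg, e']

/-! ### Memory layout and the search for a cheapest neighbour -/

variable {n : ℕ} {G : SimpleGraph (Fin n)} {x y : Fin n}

open Classical in
/-- The adjacency matrix of `G` is in the memory. -/
def HasInput (G : SimpleGraph (Fin n)) (m : ℕ → ℕ) : Prop :=
  ∀ i j : Fin n, m (1 + n * i + j) = if G.Adj i j then 1 else 0

theorem HasInput.update {m : ℕ → ℕ} (h : HasInput G m) {a : ℕ} (ha : 1 + n * n ≤ a) (b : ℕ) :
    HasInput G (Function.update m a b) := by
  intro i j
  rw [Function.update_of_ne, h i j]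
  have h1 : n * (i + 1) ≤ n * n := Nat.mul_le_mul_left n i.2
  have := j.2
  rw [mul_add] at h1
  omega

/-- The prices as a part of the memory. -/
abbrev priceOf (n : ℕ) (m : ℕ → ℕ) (v : ℕ) : ℕ := m (1 + n * n + v)

/-- The owners as a part of the memory. -/
abbrev ownerOf (n : ℕ) (m : ℕ → ℕ) (v : ℕ) : ℕ := m (1 + n * n + n + v)

/-- The activities as a part of the memory. -/
abbrev activeOf (n : ℕ) (m : ℕ → ℕ) (v : ℕ) : ℕ := m (1 + n * n + n + n + v)

/-- The state in which the auction for `x` and `y` is run. -/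
structure Env (G : SimpleGraph (Fin n)) (x y : Fin n) (s : Store) : Prop where
  r1 : s.reg 1 = n
  r2 : s.reg 2 = 0
  r3 : s.reg 3 = 1
  r4 : s.reg 4 = 1 + n * n
  r5 : s.reg 5 = 1 + n * n + n
  r6 : s.reg 6 = 1 + n * n + n + n
  r7 : s.reg 7 = x
  r8 : s.reg 8 = y
  r9 : s.reg 9 = 1 + n * x
  r10 : s.reg 10 = 1 + n * y
  input : HasInput G s.mem

theorem Env.of_reg {s s' : Store} (h : Env G x y s) (hr : ∀ q < 11, s'.reg q = s.reg q)
    (hm : HasInput G s'.mem) : Env G x y s' :=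
  ⟨by rw [hr 1 (by omega), h.r1], by rw [hr 2 (by omega), h.r2], by rw [hr 3 (by omega), h.r3],
    by rw [hr 4 (by omega), h.r4], by rw [hr 5 (by omega), h.r5], by rw [hr 6 (by omega), h.r6],
    by rw [hr 7 (by omega), h.r7], by rw [hr 8 (by omega), h.r8], by rw [hr 9 (by omega), h.r9],
    by rw [hr 10 (by omega), h.r10], hm⟩

theorem Env.set {s : Store} (h : Env G x y s) {r : ℕ} (hr : 11 ≤ r) (v : ℕ) :
    Env G x y (s.set r v) :=
  h.of_reg (fun q hq => by rw [Store.set_reg, if_neg (by omega)]) h.input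

/-- `scan` finds a cheapest neighbour. -/
theorem scan_eval {s : Store} (h : Env G x y s) {u : Fin n} (h14 : s.reg 14 = u)
    (h15 : s.reg 15 = 1 + n * u) :
    (∀ v : Fin n, u = v ∨ G.Adj u v → (scan.eval s).reg 17 ≤ priceOf n s.mem v) ∧
    (scan.eval s).reg 17 ≤ n ∧
    ((scan.eval s).reg 17 < n → ∃ v : Fin n, (u = v ∨ G.Adj u v) ∧
      priceOf n s.mem v = (scan.eval s).reg 17 ∧ (scan.eval s).reg 18 = 1 + n * n + v) := by
  classical
  -- The loop counts down, so the vertices from `i` on have been scanned. Register `17` starts at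
  -- the price cap `n`; if it stays there, no neighbour is affordable.
  let I : ℕ → Store → Prop := fun i s' => s'.mem = s.mem ∧ (∀ q < 17, s'.reg q = s.reg q) ∧
    (∀ v : Fin n, i ≤ v → u = v ∨ G.Adj u v → s'.reg 17 ≤ priceOf n s.mem v) ∧
    s'.reg 17 ≤ n ∧
    (s'.reg 17 < n → ∃ v : Fin n, (u = v ∨ G.Adj u v) ∧
      priceOf n s.mem v = s'.reg 17 ∧ s'.reg 18 = 1 + n * n + v)
  have key : I 0 (scan.eval s) := by
    rw [scan, eval, eval, eval, eval, eval]
    have e1 : (((s.set 18 0).set 17 ((s.set 18 0).reg 1 + (s.set 18 0).reg 2)).reg 1) = n := by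
      simp [Store.set_reg, h.r1]
    rw [e1]
    refine countdown_induction I ?_ ?_ ?_
    · refine ⟨rfl, fun q hq => ?_, fun v hv => absurd v.2 (by omega), ?_, ?_⟩
      · rw [Store.set_reg, if_neg (by omega), Store.set_reg, if_neg (by omega)]
      · simp [Store.set_reg, h.r1, h.r2]
      · simp [Store.set_reg, h.r1, h.r2]
    · rintro i hi s' ⟨hm, hr, h1, h2, h3⟩
      have hr' : ∀ q < 17, (s'.set 19 i).reg q = s.reg q := fun q hq => by
        rw [Store.set_reg, if_neg (by omega), hr q hq]
      have f19 : (s'.set 19 i).reg 19 = i := by simp [Store.set_reg]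
      have f17 : (s'.set 19 i).reg 17 = s'.reg 17 := by simp [Store.set_reg]
      have f18 : (s'.set 19 i).reg 18 = s'.reg 18 := by simp [Store.set_reg]
      have hstep := scanStep_eval (s'.set 19 i) (by rw [hr' 2 (by omega), h.r2])
        (by rw [hr' 3 (by omega), h.r3]) rfl rfl
      rw [f19, f17, f18, hr' 14 (by omega), hr' 15 (by omega), hr' 4 (by omega), h14, h15, h.r4,
        Store.set_mem, hm] at hstep
      have hadj := h.input u ⟨i, hi⟩
      dsimp only at hadj
      rw [hadj] at hstep
      have hc : (if (u : ℕ) = i then 1 else 0) + (if G.Adj u ⟨i, hi⟩ then 1 else 0) ≠ 0 ↔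
          (u = ⟨i, hi⟩ ∨ G.Adj u ⟨i, hi⟩) := by
        have : u = ⟨i, hi⟩ ↔ (u : ℕ) = i := Fin.ext_iff
        rw [this]
        by_cases h1 : (u : ℕ) = i <;> by_cases h2 : G.Adj u ⟨i, hi⟩ <;> simp [h1, h2]
      simp only [hc] at hstep
      obtain ⟨hs17, hs18⟩ := hstep
      refine ⟨?_, fun q hq => ?_, ?_⟩
      · rw [eval_mem rfl, Store.set_mem, hm]
      · rw [eval_reg_of_lt 17 rfl hq, hr' q hq]
      rw [hs17, hs18]
      split_ifs with hif
      · refine ⟨fun v hv huv => ?_, by omega, fun _ => ⟨⟨i, hi⟩, hif.1, rfl, rfl⟩⟩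
        rcases hv.eq_or_lt with rfl | hv
        · exact le_rfl
        · exact hif.2.le.trans (h1 v hv huv)
      · refine ⟨fun v hv huv => ?_, h2, h3⟩
        rcases hv.eq_or_lt with rfl | hv
        · exact not_lt.mp fun h' => hif ⟨huv, h'⟩
        · exact h1 v hv huv
    · rintro s' ⟨hm, hr, h1, h2, h3⟩
      refine ⟨hm, fun q hq => ?_, h1, h2, h3⟩
      rw [Store.set_reg, if_neg (by omega), hr q hq]
  exact ⟨fun v => key.2.2.1 v (Nat.zero_le _), key.2.2.2⟩

/-- The three arrays are overlapping views of one memory; only their values at vertices carry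
meaning. -/
theorem _root_.AuctionState.congr {p o s p' o' s' : ℕ → ℕ} (h : AuctionState G x y p o s)
    (hp : ∀ v : Fin n, p' v = p v) (ho : ∀ v : Fin n, o' v = o v)
    (hs : ∀ v : Fin n, s' (v + 1) = s (v + 1)) : AuctionState G x y p' o' s' := by
  obtain ⟨h1, h2, h3, h4, h5, h6, h7⟩ := h
  constructor <;> simpa only [hp, ho, hs]

/-! ### Bids, rounds and termination of the auction on the machine -/

/-- The auction for `x` and `y` is in progress. -/
structure Running (G : SimpleGraph (Fin n)) (x y : Fin n) (s : Store) : Prop extends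
    Env G x y s where
  state : AuctionState G x y (priceOf n s.mem) (ownerOf n s.mem) (activeOf n s.mem)

theorem Running.set {s : Store} (h : Running G x y s) {r : ℕ} (hr : 11 ≤ r) (v : ℕ) :
    Running G x y (s.set r v) :=
  ⟨h.toEnv.set hr v, h.state⟩

/-- The sum of all prices. -/
def potential (n : ℕ) (m : ℕ → ℕ) : ℕ := ∑ v : Fin n, priceOf n m v

theorem Running.potential_le {s : Store} (h : Running G x y s) : potential n s.mem ≤ n * n := by
  have := Finset.sum_le_card_nsmul (Finset.univ : Finset (Fin n)) (fun v => priceOf n s.mem v) n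
    fun v _ => h.state.price_le v
  simpa [potential] using this

/-- No left vertex bids any more. -/
abbrev IsOver (G : SimpleGraph (Fin n)) (m : ℕ → ℕ) : Prop :=
  AuctionOver G (priceOf n m) (activeOf n m)

theorem assign_mem {s : Store} (h : Env G x y s) {u v : Fin n} (h14 : s.reg 14 = u)
    (h18 : s.reg 18 = 1 + n * n + v) :
    (assign.eval s).mem = Function.update (Function.update (Function.update
      (Function.update s.mem (1 + n * n + v) (s.reg 17 + 1))
      (1 + n * n + n + n + ownerOf n s.mem v) 0)
      (1 + n * n + n + v) (u + 1)) (1 + n * n + n + n + (u + 1)) 1 := by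
  have hn : n ≠ 0 := by have := u.2; omega
  have e : 1 + n * n + v + n = 1 + n * n + n + v := by omega
  -- The previous owner is read after the new price has been stored; `n ≠ 0` separates the two
  -- cells.
  have e' : 1 + n * n + n + v ≠ 1 + n * n + v := by omega
  simp [assign, eval, Store.set_reg, h.r1, h.r2, h.r3, h.r6, h14, h18, e,
    Function.update_of_ne e']

/-- The arrays occupy consecutive blocks beyond the matrix, so the four writes amount to
`AuctionState.bid`, and exactly one price grows, by `1`. -/
theorem Running.assign {s : Store} (h : Running G x y s) {u v : Fin n} (h14 : s.reg 14 = u)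
    (hu : activeOf n s.mem (u + 1) = 0) (huv : u = v ∨ G.Adj u v)
    (h17 : priceOf n s.mem v = s.reg 17) (hn : s.reg 17 < n)
    (hmin : ∀ w : Fin n, u = w ∨ G.Adj u w → s.reg 17 ≤ priceOf n s.mem w)
    (h18 : s.reg 18 = 1 + n * n + v) :
    Running G x y (assign.eval s) ∧
      potential n (assign.eval s).mem = potential n s.mem + 1 := by
  have hm := assign_mem h.toEnv h14 h18
  have hp : ∀ w : Fin n, priceOf n (RAM.assign.eval s).mem w =
      Function.update (priceOf n s.mem) v (priceOf n s.mem v + 1) w := by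
    intro w
    rw [hm, h17]
    have h1 := w.2
    have h2 := v.2
    simp only [Function.update_apply]
    rw [if_neg (by omega), if_neg (by omega), if_neg (by omega)]
    simp only [add_right_inj]
  refine ⟨⟨h.toEnv.of_reg (fun q hq => eval_reg_of_lt 11 rfl hq s) ?_, ?_⟩, ?_⟩
  · rw [hm]
    exact (((h.input.update (by omega) _).update (by omega) _).update (by omega) _).update
      (by omega) _
  · refine (h.state.bid hu huv (h17 ▸ hn) (h17 ▸ hmin)).congr hp ?_ ?_
    · intro w
      rw [hm]
      have h1 := w.2
      have h2 := v.2
      simp only [Function.update_apply]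
      rw [if_neg (by omega)]
      simp only [add_right_inj]
      split_ifs
      · rfl
      · omega
      · omega
      · rfl
    · intro w
      rw [hm]
      have h1 := w.2
      have h2 := v.2
      simp only [Function.update_apply, add_right_inj]
      split_ifs <;> first | rfl | omega
  · have : ∀ w : Fin n, priceOf n (RAM.assign.eval s).mem w =
        priceOf n s.mem w + if w = v then 1 else 0 := by
      intro w
      rw [hp, Function.update_apply]
      by_cases e : w = v
      · simp [e]
      · rw [if_neg fun h' => e (Fin.ext h'), if_neg e, add_zero]
    simp [potential, this, Finset.sum_add_distrib]

/-- A bid either changes nothing, or raises a price. -/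
theorem Running.bid {s : Store} (h : Running G x y s) {u : Fin n} (h14 : s.reg 14 = u) :
    Running G x y (bid.eval s) ∧
      (((bid.eval s).mem = s.mem ∧ (activeOf n s.mem (u + 1) = 0 →
          ∀ v : Fin n, u = v ∨ G.Adj u v → n ≤ priceOf n s.mem v)) ∨
        (potential n (bid.eval s).mem = potential n s.mem + 1 ∧ ¬ IsOver G s.mem)) := by
  set s1 := ((s.set 21 (s.reg 6 + s.reg 14)).set 21 (s.reg 6 + s.reg 14 + s.reg 3)).set 22
    (s.mem (s.reg 6 + s.reg 14 + s.reg 3)) with hs1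
  have e1 : RAM.bid.eval s = if s1.reg 22 = 0 then
      (Cmd.seq (rowBase 15 14) (.seq scan (.seq (.sub 20 1 17) (.ite 20 RAM.assign .skip)))).eval s1
      else s1 := by
    simp [RAM.bid, eval, hs1, Store.set_reg]
  have hr1 : Running G x y s1 :=
    ((h.set (by omega) _).set (by omega) _).set (by omega) _
  have f22 : s1.reg 22 = activeOf n s.mem (u + 1) := by
    simp [hs1, Store.set_reg, h.r6, h14, h.r3, activeOf, add_assoc]
  have f14 : s1.reg 14 = u := by simp [hs1, Store.set_reg, h14]
  rw [e1, f22]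
  split_ifs with hact
  swap
  · exact ⟨hr1, Or.inl ⟨rfl, fun h' => absurd h' hact⟩⟩
  rw [eval, eval, eval]
  set s2 := (rowBase 15 14).eval s1 with hs2
  have m2 : s2.mem = s.mem := eval_mem rfl _
  have hr2 : Running G x y s2 :=
    ⟨hr1.toEnv.of_reg (fun q hq => eval_reg_of_lt 11 rfl hq _) (by rw [m2]; exact h.input),
      by rw [m2]; exact h.state⟩
  have g14 : s2.reg 14 = u := by rw [← f14]; exact eval_reg_of_lt 15 rfl (by omega) _
  have g15 : s2.reg 15 = 1 + n * u := by
    rw [hs2, rowBase_eval (by decide) (by decide) (by decide) (by decide), hr1.r1, f14]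
  obtain ⟨hmin, hle, hex⟩ := scan_eval hr2.toEnv g14 g15
  set s3 := scan.eval s2 with hs3
  have m3 : s3.mem = s.mem := by rw [← m2]; exact eval_mem rfl _
  have hr3 : Running G x y s3 :=
    ⟨hr2.toEnv.of_reg (fun q hq => eval_reg_of_lt 11 rfl hq _) (by rw [m3]; exact h.input),
      by rw [m3]; exact h.state⟩
  have k14 : s3.reg 14 = u := by rw [← g14]; exact eval_reg_of_lt 15 rfl (by omega) _
  have hr4 := hr3.set (r := 20) (by omega) (s3.reg 1 - s3.reg 17)
  have q17 : (s3.set 20 (s3.reg 1 - s3.reg 17)).reg 17 = s3.reg 17 := by simp [Store.set_reg]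
  have q14 : (s3.set 20 (s3.reg 1 - s3.reg 17)).reg 14 = u := by simp [Store.set_reg, k14]
  have q18 : (s3.set 20 (s3.reg 1 - s3.reg 17)).reg 18 = s3.reg 18 := by simp [Store.set_reg]
  have q20 : (s3.set 20 (s3.reg 1 - s3.reg 17)).reg 20 = n - s3.reg 17 := by
    simp [Store.set_reg, hr3.r1]
  rw [eval, eval, eval, q20]
  rw [m2] at hmin hex
  split_ifs with hz
  · exact ⟨hr4, Or.inl ⟨m3, fun _ v huv => (by omega : n ≤ s3.reg 17).trans (hmin v huv)⟩⟩
  · have hlt : s3.reg 17 < n := by omega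
    obtain ⟨v, huv, hv, hv'⟩ := hex hlt
    have := hr4.assign q14 (v := v) (by rw [Store.set_mem, m3]; exact hact) huv
      (by rw [Store.set_mem, m3, q17]; exact hv) (by rw [q17]; exact hlt)
      (by rw [Store.set_mem, m3, q17]; exact hmin) (by rw [q18, hv'])
    refine ⟨this.1, Or.inr ⟨by rw [this.2, Store.set_mem, m3], fun ho => ?_⟩⟩
    have := ho u hact v huv
    omega

/-- The program `f` carries out `k` rounds of the auction: unless the auction is over, the sum of
the prices rises by `k`. -/
def IsRounds (G : SimpleGraph (Fin n)) (x y : Fin n) (k : ℕ) (f : Store → Store) : Prop :=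
  ∀ s, Running G x y s → Running G x y (f s) ∧
    ∀ b, IsOver G s.mem ∨ b ≤ potential n s.mem →
      IsOver G (f s).mem ∨ b + k ≤ potential n (f s).mem

/-- If no bid changes the memory, all vertices were tested against the same prices and the auction
is over. Otherwise the first change shows that it was not over before, and the potential has risen.
-/
theorem isRounds_bids : IsRounds G x y 1 (Cmd.loop 14 bid).eval := by
  intro s h
  let I : ℕ → Store → Prop := fun i s' => Running G x y s' ∧
    ((s'.mem = s.mem ∧ ∀ u : Fin n, i ≤ u → activeOf n s.mem (u + 1) = 0 →
      ∀ v : Fin n, u = v ∨ G.Adj u v → n ≤ priceOf n s.mem v) ∨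
    (potential n s.mem + 1 ≤ potential n s'.mem ∧ ¬ IsOver G s.mem))
  have key : I 0 ((Cmd.loop 14 bid).eval s) := by
    rw [eval, h.r1]
    refine countdown_induction I ?_ ?_ ?_
    · exact ⟨h, Or.inl ⟨rfl, fun u hu => absurd u.2 (by omega)⟩⟩
    · rintro i hi s' ⟨hr, hI⟩
      obtain ⟨hb, hb'⟩ := (hr.set (r := 14) (by omega) i).bid (u := ⟨i, hi⟩)
        (by simp [Store.set_reg])
      refine ⟨hb, ?_⟩
      rw [Store.set_mem] at hb'
      rcases hI with ⟨hm, hI⟩ | ⟨hI, ho⟩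
      · rw [hm] at hb'
        rcases hb' with ⟨h1, h2⟩ | ⟨h1, h2⟩
        · refine Or.inl ⟨h1, fun u hu => ?_⟩
          rcases hu.eq_or_lt with rfl | hu
          · exact h2
          · exact hI u hu
        · exact Or.inr ⟨h1.ge, h2⟩
      · refine Or.inr ⟨?_, ho⟩
        rcases hb' with ⟨h1, _⟩ | ⟨h1, _⟩
        · rw [h1]
          exact hI
        · omega
    · rintro s' ⟨hr, hI⟩
      exact ⟨hr.set (by omega) 0, hI⟩
  refine ⟨key.1, fun b hb => ?_⟩
  rcases key.2 with ⟨h1, h2⟩ | ⟨h1, h2⟩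
  · rw [h1]
    exact Or.inl fun u => h2 u (Nat.zero_le _)
  · exact Or.inr (by have := hb.resolve_left h2; omega)

/-- The alternative with a free bound `b` chains: the conclusion of one pass is the hypothesis of
the next, so the gains add up. -/
theorem IsRounds.loop {k : ℕ} {c : Cmd} (hc : IsRounds G x y k c.eval) {r : ℕ} (hr : 11 ≤ r) :
    IsRounds G x y (n * k) (Cmd.loop r c).eval := by
  intro s h
  rw [eval, h.r1]
  suffices key : ∀ (l : ℕ) (s : Store), Running G x y s →
      Running G x y (countdown c.eval r l s) ∧ ∀ b, IsOver G s.mem ∨ b ≤ potential n s.mem →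
        IsOver G (countdown c.eval r l s).mem ∨
          b + l * k ≤ potential n (countdown c.eval r l s).mem from key n s h
  intro l
  induction l with
  | zero =>
    intro s h
    refine ⟨h.set hr 0, fun b hb => ?_⟩
    rw [zero_mul, add_zero]
    exact hb
  | succ l ih =>
    intro s h
    obtain ⟨h1, h2⟩ := hc _ (h.set hr l)
    obtain ⟨h3, h4⟩ := ih _ h1
    refine ⟨h3, fun b hb => ?_⟩
    have := h4 _ (h2 b hb)
    rwa [add_assoc, show k + l * k = (l + 1) * k by ring] at this

/-- After `n³` rounds an unfinished auction would have potential at least `n³`, above the bound `n²`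
as `n ≥ 2`. With `n²` rounds there would be no strict inequality. -/
theorem Running.auction {s : Store} (h : Running G x y s) (hn : 2 ≤ n) :
    Running G x y (RAM.auction.eval s) ∧ IsOver G (RAM.auction.eval s).mem := by
  have key : IsRounds G x y (n * (n * (n * 1))) RAM.auction.eval :=
    ((isRounds_bids.loop (r := 13) (by omega)).loop (r := 12) (by omega)).loop (r := 11)
      (by omega)
  obtain ⟨h1, h2⟩ := key s h
  refine ⟨h1, (h2 0 (Or.inr (Nat.zero_le _))).resolve_right fun h' => ?_⟩
  have := h1.potential_le
  have h3 : 2 * (n * n) ≤ n * (n * n) := Nat.mul_le_mul_right _ hn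
  have h4 : 0 < n * n := by positivity
  rw [mul_one] at h'
  omega

/-! ### Starting the auction and counting at its end -/

theorem initStep_mem {s : Store} (h : Env G x y s) {u : Fin n} (h14 : s.reg 14 = u) {c : ℕ}
    (hc : (if (u : ℕ) = x then 1 else 0) + (if (u : ℕ) = y then 1 else 0) = c) :
    (initStep.eval s).mem = Function.update (Function.update (Function.update s.mem
      (1 + n * n + u) (if c + s.mem (1 + n * x + u) = 0 then 0 else n))
      (1 + n * n + n + u) 0) (1 + n * n + n + n + (u + 1)) (c + s.mem (1 + n * y + u)) := by
  have e1 := isEq_eval (r := 20) (a := 14) (b := 7) (by decide) (by decide) (by decide)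
    (by decide) s h.r3
  have r1 := fun q h1 h2 => isEq_reg (r := 20) (a := 14) (b := 7) (q := q) h1 h2 s
  have m1 := isEq_mem (r := 20) (a := 14) (b := 7) s
  rw [initStep, eval]
  generalize (isEq 20 14 7).eval s = s1 at e1 r1 m1
  have e2 := isEq_eval (r := 21) (a := 14) (b := 8) (by decide) (by decide) (by decide)
    (by decide) s1 (by rw [r1 3 (by decide) (by decide), h.r3])
  have r2 := fun q h1 h2 => isEq_reg (r := 21) (a := 14) (b := 8) (q := q) h1 h2 s1
  have m2 := isEq_mem (r := 21) (a := 14) (b := 8) s1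
  rw [eval]
  generalize (isEq 21 14 8).eval s1 = s2 at e2 r2 m2
  -- The row of `y` is read after the price and the owner are stored; both cells lie beyond the
  -- matrix.
  have hy : ∀ a b, Function.update (Function.update s.mem (1 + n * n + u) a)
      (1 + n * n + n + u) b (1 + n * y + u) = s.mem (1 + n * y + u) := by
    intro a b
    have h1 : n * (y + 1) ≤ n * n := Nat.mul_le_mul_left n y.2
    have := u.2
    rw [mul_add] at h1
    rw [Function.update_of_ne (by omega), Function.update_of_ne (by omega)]
  have f20 : s2.reg 20 = if (u : ℕ) = x then 1 else 0 := by
    rw [r2 20 (by decide) (by decide), e1, h14, h.r7]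
  have f21 : s2.reg 21 = if (u : ℕ) = y then 1 else 0 := by
    rw [e2, r1 14 (by decide) (by decide), r1 8 (by decide) (by decide), h14, h.r8]
  have fq : ∀ q < 20, s2.reg q = s.reg q := fun q hq => by
    rw [r2 q (by omega) (by omega), r1 q (by omega) (by omega)]
  rw [eval, eval, eval, eval, eval, eval, eval, eval, eval]
  set s3 := (((s2.set 20 (s2.reg 20 + s2.reg 21)).set 21 _).set 21 _).set 21 _ with hs3
  have g21 : s3.reg 21 = c + s.mem (1 + n * x + u) := by
    simp [hs3, Store.set_reg, f20, f21, fq, h.r9, h14, m2, m1, hc]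
  have g20 : s3.reg 20 = c := by simp [hs3, Store.set_reg, f20, f21, hc]
  have gq : ∀ q < 20, s3.reg q = s.reg q := fun q hq => by
    rw [hs3, Store.set_reg, if_neg (by omega), Store.set_reg, if_neg (by omega), Store.set_reg,
      if_neg (by omega), Store.set_reg, if_neg (by omega), fq q hq]
  have gm : s3.mem = s.mem := by simp [hs3, m2, m1]
  clear_value s3
  rw [eval]
  set s4 := (Cmd.ite 21 (.add 21 1 2) .skip).eval s3 with hs4
  have k21 : s4.reg 21 = if c + s.mem (1 + n * x + u) = 0 then 0 else n := by
    rw [hs4, eval, g21]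
    split_ifs with hz
    · rw [eval, g21, hz]
    · simp [eval, Store.set_reg, gq, h.r1, h.r2]
  have kq : ∀ q, q ≠ 21 → s4.reg q = s3.reg q := fun q hq => eval_reg (by simp [writes, hq]) _
  have km : s4.mem = s.mem := by rw [hs4, eval_mem rfl, gm]
  clear_value s4
  simp only [add_assoc] at hy
  simp [eval, Store.set_reg, k21, kq, km, g20, gq, h.r2, h.r3, h.r4, h.r5, h.r6, h.r10, h14, hy,
    add_assoc]

theorem countStep_eval {s : Store} (h : Env G x y s) :
    (countStep.eval s).reg 23 = s.reg 23 + s.mem (1 + n * x + s.reg 14) ∧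
    (countStep.eval s).reg 24 = s.reg 24 + (1 - s.mem (1 + n * n + n + n + (s.reg 14 + 1))) := by
  simp [countStep, eval, Store.set_reg, h.r3, h.r6, h.r9, add_assoc]

theorem count_eval {s : Store} (h : Env G x y s) [DecidableRel G.Adj] :
    (count.eval s).reg 23 = (Finset.univ.filter fun a => G.Adj x a).card ∧
    (count.eval s).reg 24 =
      (Finset.univ.filter fun u : Fin n => activeOf n s.mem (u + 1) = 0).card := by
  let f : ℕ → ℕ := fun i => s.mem (1 + n * x + i)
  -- Flags of inactive vertices need not be `1` (the flag of `x` is `2` if `x` and `y` are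
  -- adjacent); truncated subtraction still counts only the zeros.
  let g : ℕ → ℕ := fun i => 1 - activeOf n s.mem (i + 1)
  let I : ℕ → Store → Prop := fun i s' => Env G x y s' ∧ s'.mem = s.mem ∧
    s'.reg 23 + ∑ j ∈ Finset.range i, f j = ∑ j ∈ Finset.range n, f j ∧
    s'.reg 24 + ∑ j ∈ Finset.range i, g j = ∑ j ∈ Finset.range n, g j
  have key : I 0 (count.eval s) := by
    rw [count, eval, eval, eval, eval, eval]
    have h0 : Env G x y ((s.set 23 0).set 24 0) := (h.set (by omega) 0).set (by omega) 0
    rw [h0.r1]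
    refine countdown_induction I ⟨h0, rfl, by simp [Store.set_reg], by simp [Store.set_reg]⟩ ?_ ?_
    · rintro i hi s' ⟨he, hm, h1, h2⟩
      obtain ⟨e1, e2⟩ := countStep_eval (he.set (r := 14) (by omega) i)
      have hm' : (countStep.eval (s'.set 14 i)).mem = s.mem := by rw [eval_mem rfl, Store.set_mem, hm]
      have f14 : (s'.set 14 i).reg 14 = i := by simp [Store.set_reg]
      have f23 : (s'.set 14 i).reg 23 = s'.reg 23 := by simp [Store.set_reg]
      have f24 : (s'.set 14 i).reg 24 = s'.reg 24 := by simp [Store.set_reg]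
      rw [Store.set_mem, hm, f14] at e1 e2
      refine ⟨(he.set (by omega) i).of_reg (fun q hq => eval_reg_of_lt 11 rfl hq _)
        (by rw [hm']; exact h.input), hm', ?_, ?_⟩
      · rw [e1, f23, ← h1, Finset.sum_range_succ]
        ring
      · rw [e2, f24, ← h2, Finset.sum_range_succ]
        ring
    · rintro s' ⟨he, hm, h1, h2⟩
      refine ⟨he.set (by omega) 0, hm, ?_, ?_⟩
      · rw [Store.set_reg, if_neg (by omega), h1]
      · rw [Store.set_reg, if_neg (by omega), h2]
  obtain ⟨-, -, h1, h2⟩ := key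
  rw [Finset.sum_range_zero, add_zero, Finset.sum_range] at h1 h2
  rw [h1, h2, Finset.card_filter, Finset.card_filter]
  constructor
  · refine Finset.sum_congr rfl fun a _ => ?_
    simp only [f, h.input x a]
    congr
  · refine Finset.sum_congr rfl fun a _ => ?_
    simp only [g]
    split_ifs <;> omega

theorem initArrays_running {s : Store} (h : Env G x y s) : Running G x y (initArrays.eval s) := by
  classical
  let I : ℕ → Store → Prop := fun i s' => Env G x y s' ∧ ∀ v : Fin n, i ≤ v →
    priceOf n s'.mem v = (if IsRight G x y v then 0 else n) ∧ ownerOf n s'.mem v = 0 ∧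
      (activeOf n s'.mem (v + 1) = 0 ↔ IsLeft G x y v)
  have key : I 0 (initArrays.eval s) := by
    rw [initArrays, eval, h.r1]
    refine countdown_induction I ⟨h, fun v hv => absurd v.2 (by omega)⟩ ?_ ?_
    · rintro i hi s' ⟨he, hI⟩
      have hm := initStep_mem (he.set (r := 14) (by omega) i) (u := ⟨i, hi⟩)
        (by simp [Store.set_reg]) rfl
      rw [Store.set_mem] at hm
      have hx := he.input x ⟨i, hi⟩
      have hy := he.input y ⟨i, hi⟩
      dsimp only at hm hx hy
      rw [hx, hy] at hm
      refine ⟨(he.set (by omega) i).of_reg (fun q hq => eval_reg_of_lt 11 rfl hq _) ?_, ?_⟩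
      · rw [hm]
        exact ((he.input.update (by omega) _).update (by omega) _).update (by omega) _
      · intro v hv
        have hvn := v.2
        simp only [hm, Function.update_apply, priceOf, ownerOf, activeOf]
        rcases hv.eq_or_lt with rfl | hv
        · simp only [Fin.eta]
          have hx' : v = x ↔ (v : ℕ) = x := Fin.ext_iff
          have hy' : v = y ↔ (v : ℕ) = y := Fin.ext_iff
          simp only [IsRight, IsLeft, ne_eq, hx', hy']
          refine ⟨?_, ?_, ?_⟩
          · rw [if_neg (by omega), if_neg (by omega), if_pos trivial]
            by_cases h1 : (v : ℕ) = x <;> by_cases h2 : (v : ℕ) = y <;>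
              by_cases h3 : G.Adj x v <;> simp [h1, h2, h3]
          · rw [if_neg (by omega), if_pos trivial]
          · rw [if_pos trivial]
            by_cases h1 : (v : ℕ) = x <;> by_cases h2 : (v : ℕ) = y <;>
              by_cases h3 : G.Adj y v <;> simp [h1, h2, h3]
        · obtain ⟨h1, h2, h3⟩ := hI v hv
          refine ⟨?_, ?_, ?_⟩
          · rw [if_neg (by omega), if_neg (by omega), if_neg (by omega)]
            exact h1
          · rw [if_neg (by omega), if_neg (by omega), if_neg (by omega)]
            exact h2
          · rw [if_neg (by omega), if_neg (by omega), if_neg (by omega)]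
            exact h3
    · rintro s' ⟨he, hI⟩
      exact ⟨he.set (by omega) 0, hI⟩
  obtain ⟨he, hI⟩ := key
  replace hI := fun v : Fin n => hI v (Nat.zero_le _)
  generalize initArrays.eval s = s' at he hI
  refine ⟨he, ?_, ?_, ?_, ?_, ?_, ?_, ?_⟩
  · intro v
    rw [(hI v).1]
    split_ifs <;> omega
  · intro v hv
    rw [(hI v).1, if_neg hv]
  · intro v hv _
    rw [(hI v).1, if_pos hv]
  · exact fun v hv => absurd (hI v).2.1 hv
  · exact fun v hv => absurd (hI v).2.1 hv
  · exact fun v _ hv => absurd (hI v).2.1 hv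
  · intro u
    rw [(hI u).2.2]
    refine (and_iff_left fun v => ?_).symm
    rw [(hI v).2.1]
    omega

/-- The local connectivity of two vertices is computed. -/
theorem localConn_eval {s : Store} (h1 : s.reg 1 = n) (h2 : s.reg 2 = 0) (h3 : s.reg 3 = 1)
    (h4 : s.reg 4 = 1 + n * n) (h5 : s.reg 5 = 1 + n * n + n) (h6 : s.reg 6 = 1 + n * n + n + n)
    (h7 : s.reg 7 = x) (h8 : s.reg 8 = y) (hG : HasInput G s.mem) (hxy : x ≠ y) (hn : 2 ≤ n) :
    HasInput G (localConn.eval s).mem ∧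
    (localConn.eval s).reg 23 = G.completeBiorientation.localStrongConnectivity {x, y} := by
  classical
  rw [localConn, eval, eval]
  set s1 := (rowBase 9 7).eval s with hs1
  have f1 : ∀ q < 9, s1.reg q = s.reg q := fun q hq => eval_reg_of_lt 9 rfl hq _
  have e9 : s1.reg 9 = 1 + n * x := by
    rw [hs1, rowBase_eval (by decide) (by decide) (by decide) (by decide), h1, h7]
  set s2 := (rowBase 10 8).eval s1 with hs2
  have f2 : ∀ q < 10, s2.reg q = s1.reg q := fun q hq => eval_reg_of_lt 10 rfl hq _
  have e10 : s2.reg 10 = 1 + n * y := by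
    rw [hs2, rowBase_eval (by decide) (by decide) (by decide) (by decide), f1 1 (by omega),
      f1 8 (by omega), h1, h8]
  have hm : s2.mem = s.mem := by rw [hs2, eval_mem rfl, hs1, eval_mem rfl]
  have f : ∀ q < 9, s2.reg q = s.reg q := fun q hq => by rw [f2 q (by omega), f1 q hq]
  have henv : Env G x y s2 :=
    ⟨by rw [f 1 (by omega), h1], by rw [f 2 (by omega), h2], by rw [f 3 (by omega), h3],
      by rw [f 4 (by omega), h4], by rw [f 5 (by omega), h5], by rw [f 6 (by omega), h6],
      by rw [f 7 (by omega), h7], by rw [f 8 (by omega), h8], by rw [f2 9 (by omega), e9], e10,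
      by rw [hm]; exact hG⟩
  rw [eval, eval, eval, eval]
  have hr := initArrays_running henv
  generalize initArrays.eval s2 = s3 at hr
  obtain ⟨hr4, hover⟩ := hr.auction hn
  generalize auction.eval s3 = s4 at hr4 hover
  obtain ⟨c1, c2⟩ := count_eval hr4.toEnv
  have hloc := hr4.state.localStrongConnectivity hover hxy
  rw [Store.set_mem, eval_mem rfl]
  refine ⟨hr4.input, ?_⟩
  rw [Store.set_reg, if_pos rfl, c1, c2, ← hloc]
  exact Nat.add_sub_cancel ..

/-! ### The minimum over all pairs -/

/-- The state in which the minimum over all pairs of vertices is computed. -/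
structure MainEnv (G : SimpleGraph (Fin n)) (s : Store) : Prop where
  r1 : s.reg 1 = n
  r2 : s.reg 2 = 0
  r3 : s.reg 3 = 1
  r4 : s.reg 4 = 1 + n * n
  r5 : s.reg 5 = 1 + n * n + n
  r6 : s.reg 6 = 1 + n * n + n + n
  input : HasInput G s.mem
  attained : s.reg 0 = n ∨ ∃ x y : Fin n, x ≠ y ∧
    s.reg 0 = G.completeBiorientation.localStrongConnectivity {x, y}

theorem MainEnv.set {s : Store} (h : MainEnv G s) {r : ℕ} (hr : 7 ≤ r) (v : ℕ) :
    MainEnv G (s.set r v) := by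
  obtain ⟨h1, h2, h3, h4, h5, h6, h7, h8⟩ := h
  have e : ∀ q < 7, (s.set r v).reg q = s.reg q := fun q hq => by
    rw [Store.set_reg, if_neg (by omega)]
  constructor <;> first | assumption | (rw [e _ (by omega)]; assumption)

theorem MainEnv.pairStep {s : Store} (h : MainEnv G s) (hn : 2 ≤ n) (h7 : s.reg 7 = x)
    (h8 : s.reg 8 = y) :
    MainEnv G (pairStep.eval s) ∧ (pairStep.eval s).reg 0 ≤ s.reg 0 ∧ (x ≠ y →
      (pairStep.eval s).reg 0 ≤ G.completeBiorientation.localStrongConnectivity {x, y}) := by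
  have e1 := isEq_eval (r := 20) (a := 7) (b := 8) (by decide) (by decide) (by decide)
    (by decide) s h.r3
  have m1 : ((isEq 20 7 8).eval s).mem = s.mem := isEq_mem s
  have f1 : ∀ q < 20, ((isEq 20 7 8).eval s).reg q = s.reg q := fun q hq =>
    eval_reg_of_lt 20 rfl hq s
  rw [RAM.pairStep, eval]
  generalize (isEq 20 7 8).eval s = s1 at e1 m1 f1
  obtain ⟨h1, h2, h3, h4, h5, h6, hG, hat⟩ := h
  rw [h7, h8] at e1
  rw [eval, e1]
  have hm1 : MainEnv G s1 :=
    ⟨by rw [f1 1 (by omega), h1], by rw [f1 2 (by omega), h2], by rw [f1 3 (by omega), h3],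
      by rw [f1 4 (by omega), h4], by rw [f1 5 (by omega), h5], by rw [f1 6 (by omega), h6],
      by rw [m1]; exact hG, by rw [f1 0 (by omega)]; exact hat⟩
  by_cases hxy : x = y
  · rw [if_pos (congrArg Fin.val hxy), if_neg one_ne_zero]
    exact ⟨hm1, (f1 0 (by omega)).le, fun h' => absurd hxy h'⟩
  rw [if_neg fun h' => hxy (Fin.ext h'), if_pos rfl, eval, eval, eval, eval]
  obtain ⟨hl1, hl2⟩ := localConn_eval hm1.r1 hm1.r2 hm1.r3 hm1.r4 hm1.r5 hm1.r6
    (by rw [f1 7 (by omega), h7]) (by rw [f1 8 (by omega), h8]) hm1.input hxy hn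
  have f2 : ∀ q < 9, (localConn.eval s1).reg q = s.reg q := fun q hq => by
    rw [eval_reg_of_lt 9 rfl hq, f1 q (by omega)]
  generalize localConn.eval s1 = s2 at hl1 hl2 f2
  have f24 : (s2.set 24 (s2.reg 0 - s2.reg 23)).reg 24 = s2.reg 0 - s2.reg 23 := by
    simp [Store.set_reg]
  rw [f24]
  have hm2 : MainEnv G s2 :=
    ⟨by rw [f2 1 (by omega), h1], by rw [f2 2 (by omega), h2], by rw [f2 3 (by omega), h3],
      by rw [f2 4 (by omega), h4], by rw [f2 5 (by omega), h5], by rw [f2 6 (by omega), h6],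
      hl1, by rw [f2 0 (by omega)]; exact hat⟩
  have hm3 := hm2.set (r := 24) (by omega) (s2.reg 0 - s2.reg 23)
  have f0 : (s2.set 24 (s2.reg 0 - s2.reg 23)).reg 0 = s2.reg 0 := by simp [Store.set_reg]
  split_ifs with hz
  · refine ⟨hm3, ?_, fun _ => ?_⟩
    · rw [eval, f0, f2 0 (by omega)]
    · rw [eval, f0, ← hl2]
      omega
  · have f0' : ((Cmd.add 0 23 2).eval (s2.set 24 (s2.reg 0 - s2.reg 23))).reg 0 = s2.reg 23 := by
      simp [eval, Store.set_reg, hm2.r2]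
    have fq : ∀ q, 0 < q → ((Cmd.add 0 23 2).eval (s2.set 24 (s2.reg 0 - s2.reg 23))).reg q =
        (s2.set 24 (s2.reg 0 - s2.reg 23)).reg q := fun q hq => by
      rw [eval, Store.set_reg, if_neg (by omega)]
    refine ⟨⟨?_, ?_, ?_, ?_, ?_, ?_, hl1, Or.inr ⟨x, y, hxy, ?_⟩⟩, ?_, fun _ => ?_⟩
    · rw [fq 1 (by omega), hm3.r1]
    · rw [fq 2 (by omega), hm3.r2]
    · rw [fq 3 (by omega), hm3.r3]
    · rw [fq 4 (by omega), hm3.r4]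
    · rw [fq 5 (by omega), hm3.r5]
    · rw [fq 6 (by omega), hm3.r6]
    · rw [f0', hl2]
    · rw [f0', ← f2 0 (by omega)]
      omega
    · rw [f0', hl2]

theorem MainEnv.row {s : Store} (h : MainEnv G s) (hn : 2 ≤ n) (h7 : s.reg 7 = x) :
    MainEnv G ((Cmd.loop 8 RAM.pairStep).eval s) ∧
      ((Cmd.loop 8 RAM.pairStep).eval s).reg 0 ≤ s.reg 0 ∧
      ∀ y, x ≠ y → ((Cmd.loop 8 RAM.pairStep).eval s).reg 0 ≤
        G.completeBiorientation.localStrongConnectivity {x, y} := by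
  let I : ℕ → Store → Prop := fun i s' => MainEnv G s' ∧ s'.reg 7 = x ∧ s'.reg 0 ≤ s.reg 0 ∧
    ∀ y : Fin n, i ≤ y → x ≠ y →
      s'.reg 0 ≤ G.completeBiorientation.localStrongConnectivity {x, y}
  have key : I 0 ((Cmd.loop 8 RAM.pairStep).eval s) := by
    rw [eval, h.r1]
    refine countdown_induction I ⟨h, h7, le_rfl, fun v hv => absurd v.2 (by omega)⟩ ?_ ?_
    · rintro i hi s' ⟨he, h7', h0, hI⟩
      have g7 : (s'.set 8 i).reg 7 = x := by simp [Store.set_reg, h7']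
      obtain ⟨k1, k2, k3⟩ := (he.set (r := 8) (by omega) i).pairStep hn (y := ⟨i, hi⟩) g7
        (by simp [Store.set_reg])
      have g0 : (s'.set 8 i).reg 0 = s'.reg 0 := by simp [Store.set_reg]
      rw [g0] at k2
      refine ⟨k1, ?_, k2.trans h0, fun y hy hxy => ?_⟩
      · rw [eval_reg (by decide), g7]
      · rcases hy.eq_or_lt with rfl | hy
        · exact k3 hxy
        · exact k2.trans (hI y hy hxy)
    · rintro s' ⟨he, h7', h0, hI⟩
      refine ⟨he.set (by omega) 0, ?_, ?_⟩
      · rw [Store.set_reg, if_neg (by omega), h7']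
      · rw [Store.set_reg, if_neg (by omega)]
        exact ⟨h0, hI⟩
  exact ⟨key.1, key.2.2.1, fun y => key.2.2.2 y (Nat.zero_le _)⟩

theorem MainEnv.table {s : Store} (h : MainEnv G s) (hn : 2 ≤ n) :
    MainEnv G ((Cmd.loop 7 (.loop 8 RAM.pairStep)).eval s) ∧
      ∀ x y, x ≠ y → ((Cmd.loop 7 (.loop 8 RAM.pairStep)).eval s).reg 0 ≤
        G.completeBiorientation.localStrongConnectivity {x, y} := by
  let I : ℕ → Store → Prop := fun i s' => MainEnv G s' ∧
    ∀ x : Fin n, i ≤ x → ∀ y : Fin n, x ≠ y →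
      s'.reg 0 ≤ G.completeBiorientation.localStrongConnectivity {x, y}
  have key : I 0 ((Cmd.loop 7 (.loop 8 RAM.pairStep)).eval s) := by
    rw [eval, h.r1]
    refine countdown_induction I ⟨h, fun v hv => absurd v.2 (by omega)⟩ ?_ ?_
    · rintro i hi s' ⟨he, hI⟩
      obtain ⟨k1, k2, k3⟩ := (he.set (r := 7) (by omega) i).row hn (x := ⟨i, hi⟩)
        (by simp [Store.set_reg])
      have g0 : (s'.set 7 i).reg 0 = s'.reg 0 := by simp [Store.set_reg]
      rw [g0] at k2
      refine ⟨k1, fun x hx y hxy => ?_⟩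
      rcases hx.eq_or_lt with rfl | hx
      · exact k3 y hxy
      · exact k2.trans (hI x hx y hxy)
    · rintro s' ⟨he, hI⟩
      refine ⟨he.set (by omega) 0, ?_⟩
      rw [Store.set_reg, if_neg (by omega)]
      exact hI
  exact ⟨key.1, fun x => key.2 x (Nat.zero_le _)⟩

/-- The other `n - 2` vertices separate `x` from `y` up to their edge. So `n` can serve as infinity
when the minimum is initialised. -/
theorem _root_.SimpleGraph.localStrongConnectivity_lt (G : SimpleGraph (Fin n)) (hxy : x ≠ y) :
    G.completeBiorientation.localStrongConnectivity {x, y} < n := by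
  have h := card_le_of_separator (X := ∅) (C := (Finset.univ.erase x).erase y) hxy (by simp)
    (by simp) (by simp) (by simp; tauto)
    (G.completeBiorientation.isGreatest_localStrongConnectivity _ (Finset.card_pair hxy).ge).1
  rw [Finset.card_erase_of_mem (by simp [hxy.symm]), Finset.card_erase_of_mem (by simp),
    Finset.card_univ, Fintype.card_fin] at h
  have : (x : ℕ) ≠ y := fun h => hxy (Fin.ext h)
  split_ifs at h <;> omega

theorem loopsOk_main : main.LoopsOk := by
  simp only [main, rowBase, pairStep, isEq, localConn, initArrays, initStep, auction, bid, scan,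
    scanStep, assign, count, countStep, LoopsOk, and_true, true_and]
  decide

/-- The program computes the strong subgraph 2-connectivity. -/
theorem main_eval {s : Store} (h1 : s.reg 1 = n) (h2 : s.reg 2 = 0) (h3 : s.reg 3 = 1)
    (hG : HasInput G s.mem) (hn : 2 ≤ n) :
    (main.eval s).reg 0 = G.completeBiorientation.strongConnectivity 2 := by
  rw [main, eval]
  have e4 := rowBase_eval (r := 4) (a := 1) (by decide) (by decide) (by decide) (by decide) s
  have fq : ∀ q < 4, ((rowBase 4 1).eval s).reg q = s.reg q := fun q hq =>
    eval_reg_of_lt 4 rfl hq s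
  have hm : ((rowBase 4 1).eval s).mem = s.mem := eval_mem rfl _
  generalize (rowBase 4 1).eval s = s1 at e4 fq hm
  rw [h1] at e4
  change ((Cmd.loop 7 (.loop 8 pairStep)).eval ((Cmd.add 0 1 2).eval ((Cmd.add 6 5 1).eval
    ((Cmd.add 5 4 1).eval s1)))).reg 0 = _
  have henv : MainEnv G ((Cmd.add 0 1 2).eval ((Cmd.add 6 5 1).eval ((Cmd.add 5 4 1).eval s1))) := by
    constructor <;> simp [eval, Store.set_reg, fq, h1, h2, h3, e4, hm, hG]
  obtain ⟨⟨-, -, -, -, -, -, -, hat⟩, hle⟩ := henv.table hn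
  generalize (Cmd.loop 7 (.loop 8 pairStep)).eval _ = s2 at hat hle ⊢
  have hxy : (⟨0, by omega⟩ : Fin n) ≠ ⟨1, by omega⟩ := by simp
  -- The pair of vertices `0` and `1` exists because `n ≥ 2`, so the initial value `n` has been
  -- replaced.
  have hat' := hat.resolve_left fun h' => by
    have := hle _ _ hxy
    have := G.localStrongConnectivity_lt hxy
    omega
  obtain ⟨x, y, hne, hat'⟩ := hat'
  refine le_antisymm ?_ ?_
  · refine le_csInf ⟨_, {x, y}, Finset.card_pair hne, rfl⟩ ?_
    rintro _ ⟨S, hS, rfl⟩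
    obtain ⟨u, v, huv, rfl⟩ := Finset.card_eq_two.mp hS
    exact hle u v huv
  · rw [hat']
    exact Nat.sInf_le ⟨{x, y}, Finset.card_pair hne, rfl⟩

/-! ### The input and the final time bound -/

theorem _root_.Polynomial.eval_mono_nat (q : Polynomial ℕ) {a b : ℕ} (h : a ≤ b) :
    q.eval a ≤ q.eval b := by
  rw [Polynomial.eval_eq_sum, Polynomial.eval_eq_sum]
  exact Finset.sum_le_sum fun i _ => Nat.mul_le_mul_left _ (Nat.pow_le_pow_left h i)

/-- Each entry counts at least its separator. The `n²` matrix entries thus make the order `n` at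
most the input size, which the binary digits of `n` alone would not. -/
theorem length_le_inputSize (w : List ℕ) : w.length ≤ inputSize w := by
  unfold inputSize
  induction w with
  | nil => simp
  | cons a w ih => simp only [List.length_cons, List.map_cons, List.sum_cons]; omega

end RAM

theorem FiniteGraph.hasInput (G : FiniteGraph) :
    RAM.HasInput G.graph (RAM.init G.encode).mem := by
  classical
  intro i j
  have hlt : G.n * i + j < G.n * G.n := by
    have h1 : G.n * (i + 1) ≤ G.n * G.n := Nat.mul_le_mul_left G.n i.2
    have := j.2
    rw [mul_add] at h1
    omega
  have hd : (⟨G.n * i + j, hlt⟩ : Fin (G.n * G.n)).divNat = i := by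
    ext
    simp only [Fin.divNat]
    rw [Nat.mul_add_div (by have := i.2; omega), Nat.div_eq_of_lt j.2, add_zero]
  have hm : (⟨G.n * i + j, hlt⟩ : Fin (G.n * G.n)).modNat = j := by
    ext
    simp only [Fin.modNat]
    rw [Nat.mul_add_mod, Nat.mod_eq_of_lt j.2]
  simp only [RAM.init, FiniteGraph.encode]
  rw [show 1 + G.n * (i : ℕ) + j = (G.n * i + j) + 1 by ring, List.getD_cons_succ,
    List.getD_eq_getElem _ _ (by simpa using hlt), List.getElem_ofFn, hd, hm]

theorem mainTheorem8 :
    RAM.PolyTimeComputable FiniteGraph.encode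
      (fun G : FiniteGraph => G.graph.completeBiorientation.strongConnectivity 2) := by
  -- The two extra instructions set up the reserved registers: `3` gets `1`, and `1` gets the order
  -- from cell `0`, addressed by register `2`, which is still `0`.
  refine ⟨.const 3 1 :: .load 1 2 :: RAM.main.compile 2, 1 + 1 + RAM.main.cost, fun G => ?_⟩
  set P : RAM.Program := .const 3 1 :: .load 1 2 :: RAM.main.compile 2 with hP
  have hcode : RAM.CodeAt P 0 P := fun k i h => by rwa [zero_add]
  let s : RAM.Store := ((⟨fun _ => 0, (RAM.init G.encode).mem⟩ : RAM.Store).set 3 1).set 1 G.n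
  have hs1 : s.reg 1 = G.n := by simp [s, RAM.Store.set_reg]
  have hs2 : s.reg 2 = 0 := by simp [s, RAM.Store.set_reg]
  have hs3 : s.reg 3 = 1 := by simp [s, RAM.Store.set_reg]
  have r1 : RAM.RunsIn P 1 (RAM.init G.encode)
      (((⟨fun _ => 0, (RAM.init G.encode).mem⟩ : RAM.Store).set 3 1).at 1) :=
    RAM.RunsIn.one hcode.head rfl
  have r2 : RAM.RunsIn P 1
      (((⟨fun _ => 0, (RAM.init G.encode).mem⟩ : RAM.Store).set 3 1).at 1) (s.at 2) :=
    RAM.RunsIn.one hcode.tail.head rfl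
  have r3 := RAM.Cmd.runsIn_compile (P := P) RAM.main RAM.loopsOk_main
    (by decide) (by decide) (by decide) hcode.tail.tail s hs2 hs3
  obtain ⟨t, ht, e⟩ := (r1.trans r2).trans r3
  have hsize : G.n ≤ RAM.inputSize G.encode := by
    refine le_trans ?_ (RAM.length_le_inputSize _)
    simp only [FiniteGraph.encode, List.length_cons, List.length_ofFn]
    exact (Nat.le_mul_self _).trans (Nat.le_succ _)
  refine ⟨t, ht.trans ?_, ?_, ?_⟩
  · rw [Polynomial.eval_add, Polynomial.eval_add, Polynomial.eval_one, hs1]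
    exact Nat.add_le_add_left (RAM.main.cost.eval_mono_nat hsize) _
  · rw [e]
    simp [RAM.Halted, RAM.Store.at, hP]
    omega
  · rw [e]
    exact RAM.main_eval hs1 hs2 hs3 G.hasInput G.two_le
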